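/- Let $N\ge 2$, $1<p<N$, and let $\Omega\subset\mathbb R^N$ be a bounded open set with Lipschitz boundary. Let $a:\Omega\times\mathbb R^N\to\mathbb R^N$ be a Carathéodory function satisfying the Leray–Lions conditions: there are $\alpha,\beta>0$ and $0\le z\in L^{p/(p-1)}(\Omega)$ such that, for almost every $x\in\Omega$ and all $\xi\ne\xi'$ in $\mathbb R^N$, $$a(x,\xi)\cdot\xi\ge\alpha|\xi|^p,\qquad |a(x,\xi)|\le\beta\,(z(x)+|\xi|^{p-1}),\qquad (a(x,\xi)-a(x,\xi'))\cdot(\xi-\xi')>0.$$ Let $f\in L^1(\Omega)$, and let $\lambda,g\in L^1(\partial\Omega)$ with $\lambda,g\ge 0$ $\mathcal H^{N-1}$-almost everywhere on $\partial\Omega$. Assume that $\lambda$ is not identically null on the boundary of any connected component of $\Omega$ (if $\Omega$ is connected, this says that $\lambda$ is not identically null on $\partial\Omega$). Let $\sigma:[0,\infty)\to\mathbb R$ be continuous and strictly increasing. Let $h:[0,\infty)\to(-\infty,+\infty]$ be nonincreasing, finite and continuous on $(0,\infty)$, with $h(0)=\lim_{s\to0^+}h(s)$ (possibly $+\infty$).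 Consider the problem $$-\operatorname{div}a(x,\nabla u)=f,\quad u\ge0\ \text{ in }\Omega,\qquad a(x,\nabla u)\cdot\nu+\lambda\,\sigma(u)=h(u)\,g\ \text{ on }\partial\Omega .$$ Write $T_k(s)=\max(-k,\min(s,k))$. An *entropy solution* is a measurable, almost everywhere finite function $u\ge 0$ on $\Omega$ such that, for all $k>0$, $T_k(u)\in W^{1,p}(\Omega)$ and $a(x,\nabla T_k(u))\in L^{p/(p-1)}(\Omega)^N$, such that $\lambda\sigma(u),\,h(u)g\in L^1(\partial\Omega)$ (with the convention $0\cdot\infty=0$), and such that $$\int_\Omega a(x,\nabla u)\cdot\nabla T_k(u-v)+\int_{\partial\Omega}\lambda\sigma(u)T_k(u-v)\,d\mathcal H^{N-1}=\int_\Omega f\,T_k(u-v)+\int_{\partial\Omega}h(u)g\,T_k(u-v)\,d\mathcal H^{N-1}$$ for all $v\in W^{1,p}(\Omega)\cap L^\infty(\Omega)$ and all $k>0$. Here $\nabla u$ is the measurable function with $\nabla T_k(u)=\nabla u\,\chi_{\{|u|\le k\}}$ almost everywhere for all $k>0$, and on $\partial\Omega$ the functions $u$ and $v$ stand for their traces,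 the trace of $u$ being the ($\mathcal H^{N-1}$-almost everywhere finite) function $w$ such that $T_k(w)$ is the trace of $T_k(u)$ for all $k>0$. Then the problem has at most one entropy solution: any two entropy solutions coincide almost everywhere in $\Omega$, and their traces coincide $\mathcal H^{N-1}$-almost everywhere on $\partial\Omega$. -/

import Mathlib

open MeasureTheory Set Filter Topology
open scoped NNReal ENNReal ContDiff

/-- Euclidean space `ℝ^N`. -/
abbrev Eucl (N : ℕ) : Type := EuclideanSpace ℝ (Fin N)

/-- The truncation `T_k(s) = max (-k) (min s k)`. -/
def trunc (k s : ℝ) : ℝ := max (-k) (min s k)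

/-- The boundary of `Ω` is Lipschitz: near each boundary point, after a choice of a unit
vector `e` as vertical direction, `Ω` is the strict supergraph of a Lipschitz function of the
component `y - ⟪e, y⟫ e` orthogonal to `e`. -/
def HasLipschitzBoundary {N : ℕ} (Ω : Set (Eucl N)) : Prop :=
  ∀ x ∈ frontier Ω, ∃ (e : Eucl N) (γ : Eucl N → ℝ) (K : ℝ≥0) (r : ℝ),
    ‖e‖ = 1 ∧ LipschitzWith K γ ∧ 0 < r ∧
      ∀ y ∈ Metric.ball x r, (y ∈ Ω ↔ γ (y - inner ℝ e y • e) < inner ℝ e y)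

/-- Lebesgue measure on `Ω`. -/
noncomputable def volOn {N : ℕ} (Ω : Set (Eucl N)) : Measure (Eucl N) :=
  volume.restrict Ω

/-- The surface measure on a set `S` (a boundary): the `(N-1)`-dimensional Hausdorff measure with
its usual normalization (the one that agrees with Lebesgue measure on `ℝ^(N-1)`). -/
noncomputable def surfOn {N : ℕ} (S : Set (Eucl N)) : Measure (Eucl N) :=
  (Measure.euclideanHausdorffMeasure (N - 1)).restrict S

/-- `w ∈ W^{1,p}(Ω)` with weak gradient `D`: both are in `L^p(Ω)`, and
`∫_Ω w ∂_e φ = - ∫_Ω (D · e) φ` for all `φ ∈ C_c^∞(Ω)` and all directions `e`. -/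
structure HasSobolevGradient {N : ℕ} (Ω : Set (Eucl N)) (p : ℝ)
    (w : Eucl N → ℝ) (D : Eucl N → Eucl N) : Prop where
  memLp : MemLp w (ENNReal.ofReal p) (volOn Ω)
  memLp_grad : MemLp D (ENNReal.ofReal p) (volOn Ω)
  integral_eq : ∀ φ : Eucl N → ℝ, ContDiff ℝ ∞ φ → HasCompactSupport φ → tsupport φ ⊆ Ω →
    ∀ e : Eucl N,
      ∫ x, w x * fderiv ℝ φ x e ∂volOn Ω = - ∫ x, inner ℝ (D x) e * φ x ∂volOn Ω

/-- The Sobolev space `W^{1,p}(Ω)`. -/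
def MemSobolev {N : ℕ} (Ω : Set (Eucl N)) (p : ℝ) (w : Eucl N → ℝ) : Prop :=
  ∃ D, HasSobolevGradient Ω p w D

/-- `τ` is the boundary trace of `v`: at `ℋ^{N-1}`-almost every `x ∈ ∂Ω`, the number `τ x` is the
one-sided Lebesgue value of `v`, that is, the mean of `|v - τ x|` over `Ω ∩ B(x, r)` tends to `0`
as `r → 0`. Every `v ∈ W^{1,p}(Ω)`, with `Ω` bounded and Lipschitz, has such a trace, and it is the
value of the usual trace operator. -/
def IsTrace {N : ℕ} (Ω : Set (Eucl N)) (v τ : Eucl N → ℝ) : Prop :=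
  ∀ᵐ x ∂surfOn (frontier Ω),
    Tendsto (fun r : ℝ => ⨍ y in Ω ∩ Metric.ball x r, |v y - τ x|) (𝓝[>] 0) (𝓝 0)

/-- All truncations `T_k(u)` are in `W^{1,p}(Ω)`, and `G` is the generalized gradient of `u`:
`∇ T_k(u) = G χ_{|u| ≤ k}` for all `k > 0`. -/
def HasTruncGradient {N : ℕ} (Ω : Set (Eucl N)) (p : ℝ)
    (u : Eucl N → ℝ) (G : Eucl N → Eucl N) : Prop :=
  AEMeasurable G (volOn Ω) ∧
  ∀ k : ℝ, 0 < k →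
    HasSobolevGradient Ω p (fun x => trunc k (u x)) ({x | |u x| ≤ k}.indicator G)

/-- `w` is the boundary trace of a function `u` of which only the truncations are Sobolev
functions: `T_k(w)` is the trace of `T_k(u)` for all `k > 0`. -/
def IsTruncTrace {N : ℕ} (Ω : Set (Eucl N)) (u w : Eucl N → ℝ) : Prop :=
  ∀ k : ℝ, 0 < k → IsTrace Ω (fun x => trunc k (u x)) (fun x => trunc k (w x))

/-- The Leray-Lions conditions with exponent `p` on a Caratheodory function
`a : Ω × ℝ^N → ℝ^N`: coercivity, growth, strict monotonicity. -/
structure IsLerayLions {N : ℕ} (Ω : Set (Eucl N)) (p : ℝ)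
    (a : Eucl N → Eucl N → Eucl N) : Prop where
  measurable : ∀ ξ, AEMeasurable (fun x => a x ξ) (volOn Ω)
  continuous : ∀ᵐ x ∂volOn Ω, Continuous (a x)
  coercive : ∃ α : ℝ, 0 < α ∧ ∀ᵐ x ∂volOn Ω, ∀ ξ, α * ‖ξ‖ ^ p ≤ inner ℝ (a x ξ) ξ
  growth : ∃ (β : ℝ) (z : Eucl N → ℝ), 0 < β ∧ (∀ᵐ x ∂volOn Ω, 0 ≤ z x) ∧
    MemLp z (ENNReal.ofReal (p / (p - 1))) (volOn Ω) ∧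
    ∀ᵐ x ∂volOn Ω, ∀ ξ, ‖a x ξ‖ ≤ β * (z x + ‖ξ‖ ^ (p - 1))
  monotone : ∀ᵐ x ∂volOn Ω, ∀ ξ ξ', ξ ≠ ξ' → 0 < inner ℝ (a x ξ - a x ξ') (ξ - ξ')

/-- `u` is an entropy solution of `-div a(x, ∇u) = f` and `u ≥ 0` in `Ω`,
`a(x, ∇u) · ν + lam σ(u) = h(u) g` on `∂Ω`. Here `G` is the generalized gradient of `u` and `w` its
boundary trace. The function `h` may be infinite at `0`, so `h(u) g` is formed in the extended reals
(with `0 * ∞ = 0`); that it is in `L^1(∂Ω)` means that it is finite almost everywhere and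
integrable. In the identity, `D` is the weak gradient of `T_k(u - v)`, and `τ` is the trace
of `v`. -/
def IsEntropySolution {N : ℕ} (Ω : Set (Eucl N)) (p : ℝ) (a : Eucl N → Eucl N → Eucl N)
    (f lam g : Eucl N → ℝ) (σ : ℝ → ℝ) (h : ℝ → EReal) (u : Eucl N → ℝ) : Prop :=
  AEMeasurable u (volOn Ω) ∧ (∀ᵐ x ∂volOn Ω, 0 ≤ u x) ∧
  ∃ (G : Eucl N → Eucl N) (w : Eucl N → ℝ),
    HasTruncGradient Ω p u G ∧ IsTruncTrace Ω u w ∧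
    (∀ k : ℝ, 0 < k → MemLp (fun x => a x ({y | |u y| ≤ k}.indicator G x))
      (ENNReal.ofReal (p / (p - 1))) (volOn Ω)) ∧
    Integrable (fun x => lam x * σ (w x)) (surfOn (frontier Ω)) ∧
    (∀ᵐ x ∂surfOn (frontier Ω), h (w x) * (g x : EReal) ≠ ⊤ ∧ h (w x) * (g x : EReal) ≠ ⊥) ∧
    Integrable (fun x => (h (w x) * (g x : EReal)).toReal) (surfOn (frontier Ω)) ∧
    ∀ v τ : Eucl N → ℝ, MemSobolev Ω p v → MemLp v ∞ (volOn Ω) → IsTrace Ω v τ →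
      ∀ k : ℝ, 0 < k → ∃ D : Eucl N → Eucl N,
        HasSobolevGradient Ω p (fun x => trunc k (u x - v x)) D ∧
        ∫ x, inner ℝ (a x (G x)) (D x) ∂volOn Ω
            + ∫ x, lam x * σ (w x) * trunc k (w x - τ x) ∂surfOn (frontier Ω)
          = ∫ x, f x * trunc k (u x - v x) ∂volOn Ω
            + ∫ x, (h (w x) * (g x : EReal)).toReal * trunc k (w x - τ x)
                ∂surfOn (frontier Ω)

/-! Each solution is tested against the truncation of the other: `v = T_r(u₂)` in the equation of
`u₁` and `v = T_r(u₁)` in that of `u₂`, always at level `k = 1`, with `r → ∞`. In the sum of the two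
identities the terms with `f` cancel in the limit because `T_1` is odd. What remains on the right is
`A - B`, where `A = ∫ (H₁ - H₂) T_1(w₁ - w₂) ≤ 0` because `h` is nonincreasing and `g ≥ 0`, and `B =
∫ λ (σ(w₁) - σ(w₂)) T_1(w₁ - w₂) ≥ 0` because `σ` increases and `λ ≥ 0`.

On the left, where both solutions are at most `r` and differ by less than `1`, the fluxes add up to
the monotonicity expression. Elsewhere coercivity gives the good sign, up to products supported
where one solution lies in `(r, r + 1]` and the other in `(r - 1, r]` (`le_inner_crossGrad_add`).
These errors vanish in the limit, since the energy on `{n < u ≤ n + 1}` tends to zero; this is seen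
by testing `u` against its own truncation (`IsEntropyTriple.tendsto_energy`). Hence `0 ≤ A - B ≤ 0`
(`IsEntropyTriple.comparison`): the gradients agree almost everywhere on `{|u₁ - u₂| < 1}`, and the
integrand of `B` is zero almost everywhere.

It follows that `T_1(u₁ - u₂)` has zero weak gradient (`IsEntropyTriple.hasWeakDeriv_zero`), as the
`L¹` limit of `T_1(u₁ - T_r(u₂))`, whose gradients live only on bands. So it is constant on every
component (`exists_ae_eq_const`). On the boundary of that component `λ ≠ 0` on a set of positive
measure, and there strict monotonicity of `σ` forces `w₁ = w₂`. Comparing means over small balls at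
such a point shows that the constant is zero (`ae_eq_of_trace_eq`). Here the Lipschitz boundary
matters: near the point, `Ω` belongs to that single component. Traces then agree because one-sided
Lebesgue values are unique. -/

/-! ### Mollification and weak derivatives -/

/-- `d` is the weak derivative of `w` in `Ω` in the direction `e`. -/
def HasWeakDeriv {N : ℕ} (Ω : Set (Eucl N)) (w d : Eucl N → ℝ) (e : Eucl N) : Prop :=
  ∀ φ : Eucl N → ℝ, ContDiff ℝ ∞ φ → HasCompactSupport φ → tsupport φ ⊆ Ω →
    ∫ x, w x * fderiv ℝ φ x e ∂volOn Ω = - ∫ x, d x * φ x ∂volOn Ω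

/-- A smooth bump function supported in the ball of radius `1 / (n + 1)`. -/
noncomputable def stdBump (N n : ℕ) : ContDiffBump (0 : Eucl N) where
  rIn := 1 / (2 * ((n : ℝ) + 1))
  rOut := 1 / ((n : ℝ) + 1)
  rIn_pos := by positivity
  rIn_lt_rOut := by
    apply one_div_lt_one_div_of_lt <;> nlinarith [(Nat.cast_nonneg n : (0 : ℝ) ≤ n)]

open scoped Convolution in
/-- The convolution with a standard mollifier of radius `1 / (n + 1)`. -/
noncomputable def mollify {N : ℕ} (n : ℕ) (w : Eucl N → ℝ) : Eucl N → ℝ :=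
  (stdBump N n).normed volume ⋆[ContinuousLinearMap.lsmul ℝ ℝ, volume] w

lemma tendsto_stdBump_rOut (N : ℕ) : Tendsto (fun n => (stdBump N n).rOut) atTop (𝓝 0) :=
  tendsto_one_div_add_atTop_nhds_zero_nat

lemma mollify_apply {N : ℕ} (n : ℕ) (w : Eucl N → ℝ) (x : Eucl N) :
    mollify n w x = ∫ t, (stdBump N n).normed volume (x - t) * w t := by
  rw [mollify, convolution_eq_swap]
  simp

lemma contDiff_mollify {N : ℕ} (n : ℕ) {w : Eucl N → ℝ} (hw : LocallyIntegrable w) :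
    ContDiff ℝ 1 (mollify n w) :=
  (stdBump N n).hasCompactSupport_normed.contDiff_convolution_left _
    ((stdBump N n).contDiff_normed (n := 1)) hw

lemma integrable_mollify {N : ℕ} (n : ℕ) {w : Eucl N → ℝ} (hw : Integrable w) :
    Integrable (mollify n w) :=
  (stdBump N n).integrable_normed.integrable_convolution _ hw

lemma integral_mollify {N : ℕ} (n : ℕ) {w : Eucl N → ℝ} (hw : Integrable w) :
    ∫ x, mollify n w x = ∫ x, w x := by
  rw [mollify, integral_convolution _ (stdBump N n).integrable_normed hw]
  simp [ContDiffBump.integral_normed]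

lemma ae_tendsto_mollify {N : ℕ} {w : Eucl N → ℝ} (hw : LocallyIntegrable w) :
    ∀ᵐ x, Tendsto (fun n => mollify n w x) atTop (𝓝 (w x)) := by
  -- The outer radius is exactly twice the inner one for every `n`; this bounded ratio gives
  -- convergence at Lebesgue points.
  refine ContDiffBump.ae_convolution_tendsto_right_of_locallyIntegrable (K := 2)
    (tendsto_stdBump_rOut N) (Eventually.of_forall fun n => ?_) hw
  show 1 / ((n : ℝ) + 1) ≤ 2 * (1 / (2 * ((n : ℝ) + 1)))
  apply le_of_eq
  field_simp

lemma abs_mollify_le {N : ℕ} (n : ℕ) (w : Eucl N → ℝ) (x : Eucl N) :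
    |mollify n w x| ≤ mollify n (fun y => |w y|) x := by
  rw [mollify_apply, mollify_apply]
  refine (abs_integral_le_integral_abs).trans (le_of_eq ?_)
  refine integral_congr_ae (Eventually.of_forall fun t => ?_)
  simp [abs_mul, abs_of_nonneg ((stdBump N n).nonneg_normed (μ := volume) _)]

/-- A version of dominated convergence in `L¹` with varying, convergent dominating functions. -/
lemma tendsto_integral_abs_sub_of_dominated {α : Type*} [MeasurableSpace α] {μ : Measure α}
    {F G : ℕ → α → ℝ} {f g : α → ℝ} (hF : ∀ n, Integrable (F n) μ) (hf : Integrable f μ)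
    (hG : ∀ n, Integrable (G n) μ) (hg : Integrable g μ)
    (hle : ∀ n, ∀ᵐ x ∂μ, |F n x| ≤ G n x)
    (hFf : ∀ᵐ x ∂μ, Tendsto (fun n => F n x) atTop (𝓝 (f x)))
    (hGg : ∀ᵐ x ∂μ, Tendsto (fun n => G n x) atTop (𝓝 (g x)))
    (hint : Tendsto (fun n => ∫ x, G n x ∂μ) atTop (𝓝 (∫ x, g x ∂μ))) :
    Tendsto (fun n => ∫ x, |F n x - f x| ∂μ) atTop (𝓝 0) := by
  -- The proof rests on `|F n - f| ≤ min |F n - f| (2 g) + (G n - g)⁺`: the first term is dominated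
  -- by `2 g`.
  have hH : ∀ n, Integrable (fun x => min (|F n x - f x|) (2 * g x)) μ := fun n =>
    ((hF n).sub hf).abs.inf (hg.const_mul 2)
  have hle' : ∀ᵐ x ∂μ, ∀ n, |F n x| ≤ G n x := ae_all_iff.2 hle
  have hfg : ∀ᵐ x ∂μ, |f x| ≤ g x := by
    filter_upwards [hle', hFf, hGg] with x h1 h2 h3
    exact le_of_tendsto_of_tendsto' h2.abs h3 h1
  have h1 : Tendsto (fun n => ∫ x, min (|F n x - f x|) (2 * g x) ∂μ) atTop (𝓝 (∫ _, (0 : ℝ) ∂μ)) := by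
    refine tendsto_integral_of_dominated_convergence (fun x => 2 * g x)
      (fun n => (hH n).aestronglyMeasurable) (hg.const_mul 2) (fun n => ?_) ?_
    · filter_upwards [hfg] with x hx
      have := abs_nonneg (f x)
      rw [Real.norm_of_nonneg (le_min (abs_nonneg _) (by linarith))]
      exact min_le_right _ _
    · filter_upwards [hFf, hfg] with x hx hx2
      have h0 : Tendsto (fun n => |F n x - f x|) atTop (𝓝 0) := by
        simpa using (hx.sub_const (f x)).abs
      have := abs_nonneg (f x)
      have := h0.min (tendsto_const_nhds (x := 2 * g x))
      rwa [min_eq_left (by linarith)] at this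
  have hE : ∀ n, Integrable (fun x => max (G n x - g x) 0) μ := fun n => ((hG n).sub hg).pos_part
  have hE' : ∀ n, Integrable (fun x => max (-(G n x - g x)) 0) μ :=
    fun n => ((hG n).sub hg).neg_part
  have h2 : Tendsto (fun n => ∫ x, max (-(G n x - g x)) 0 ∂μ) atTop (𝓝 (∫ _, (0 : ℝ) ∂μ)) := by
    refine tendsto_integral_of_dominated_convergence g
      (fun n => (hE' n).aestronglyMeasurable) hg (fun n => ?_) ?_
    · filter_upwards [hfg, hle'] with x hx hx2
      have := abs_nonneg (f x)
      have := abs_nonneg (F n x)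
      have := hx2 n
      rw [Real.norm_of_nonneg (le_max_right _ _)]
      exact max_le (by linarith) (by linarith)
    · filter_upwards [hGg] with x hx
      have := ((hx.sub_const (g x)).neg).max (tendsto_const_nhds (x := (0 : ℝ)))
      simpa using this
  -- The positive part has no fixed majorant, but the negative part is bounded by `g`, and the two
  -- differ by `∫ G n - ∫ g → 0`.
  have h3 : Tendsto (fun n => ∫ x, max (G n x - g x) 0 ∂μ) atTop (𝓝 0) := by
    have : ∀ n, ∫ x, max (G n x - g x) 0 ∂μ
        = (∫ x, G n x ∂μ - ∫ x, g x ∂μ) + ∫ x, max (-(G n x - g x)) 0 ∂μ := by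
      intro n
      rw [← integral_sub (hG n) hg, ← integral_add (f := fun x => G n x - g x) ((hG n).sub hg) (hE' n)]
      refine integral_congr_ae (Eventually.of_forall fun x => ?_)
      simp only
      rcases le_total (G n x - g x) 0 with h | h
      · rw [max_eq_right h, max_eq_left (by linarith)]; ring
      · rw [max_eq_left h, max_eq_right (by linarith)]; ring
    simp_rw [this]
    simpa using (hint.sub_const (∫ x, g x ∂μ)).add h2
  have h4 : ∀ n, ∫ x, |F n x - f x| ∂μ
      ≤ ∫ x, min (|F n x - f x|) (2 * g x) ∂μ + ∫ x, max (G n x - g x) 0 ∂μ := by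
    intro n
    rw [← integral_add (hH n) (hE n)]
    refine integral_mono_ae ((hF n).sub hf).abs ((hH n).add (hE n)) ?_
    filter_upwards [hfg, hle'] with x hx hx2
    have := hx2 n
    have h5 := abs_sub (F n x) (f x)
    have := le_max_left (G n x - g x) 0
    have := le_max_right (G n x - g x) 0
    rcases le_total (|F n x - f x|) (2 * g x) with h | h
    · rw [min_eq_left h]; linarith
    · rw [min_eq_right h]; linarith
  refine squeeze_zero (fun n => integral_nonneg fun x => abs_nonneg _) h4 ?_
  simpa using h1.add h3

/-- The mollifications of `|w|` dominate those of `w`, converge almost everywhere, and all have the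
integral of `|w|`, so the varying dominated convergence applies. -/
lemma tendsto_integral_abs_mollify_sub {N : ℕ} {w : Eucl N → ℝ} (hw : Integrable w) :
    Tendsto (fun n => ∫ x, |mollify n w x - w x|) atTop (𝓝 0) := by
  refine tendsto_integral_abs_sub_of_dominated (fun n => integrable_mollify n hw) hw
    (fun n => integrable_mollify n hw.abs) hw.abs
    (fun n => Eventually.of_forall fun x => abs_mollify_le n w x)
    (ae_tendsto_mollify hw.locallyIntegrable) (ae_tendsto_mollify hw.abs.locallyIntegrable) ?_
  simp_rw [integral_mollify _ hw.abs]
  exact tendsto_const_nhds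

/-- Mollification commutes with weak differentiation away from the boundary. -/
lemma fderiv_mollify_apply {N : ℕ} {Ω : Set (Eucl N)} (hΩ : MeasurableSet Ω) {w d : Eucl N → ℝ}
    {e : Eucl N} (hw : IntegrableOn w Ω) (h : HasWeakDeriv Ω w d e) (n : ℕ) {x : Eucl N}
    (hx : Metric.closedBall x (1 / ((n : ℝ) + 1)) ⊆ Ω) :
    fderiv ℝ (mollify n (Ω.indicator w)) x e = mollify n (Ω.indicator d) x := by
  set ρ : Eucl N → ℝ := (stdBump N n).normed volume with hρ
  have hρc : HasCompactSupport ρ := (stdBump N n).hasCompactSupport_normed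
  have hρd : ContDiff ℝ ∞ ρ := (stdBump N n).contDiff_normed
  have hW : Integrable (Ω.indicator w) := (integrable_indicator_iff hΩ).2 hw
  have hder := hρc.hasFDerivAt_convolution_left (ContinuousLinearMap.lsmul ℝ ℝ)
    ((stdBump N n).contDiff_normed (n := 1)) hW.locallyIntegrable x
  have hex : ConvolutionExistsAt (fderiv ℝ ρ) (Ω.indicator w) x
      ((ContinuousLinearMap.lsmul ℝ ℝ).precompL (Eucl N)) volume :=
    (hρc.fderiv ℝ).convolutionExists_left _ (hρd.continuous_fderiv (by simp))
      hW.locallyIntegrable x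
  have h1 : fderiv ℝ (mollify n (Ω.indicator w)) x e
      = ∫ t, fderiv ℝ ρ (x - t) e * Ω.indicator w t := by
    rw [mollify, hder.fderiv, convolution_def, ContinuousLinearMap.integral_apply hex]
    rw [← integral_sub_left_eq_self _ volume x]
    simp [ContinuousLinearMap.precompL_apply, hρ]
  -- The translated, reflected kernel is an admissible test function because its support lies in the
  -- closed ball inside `Ω`; the reflection supplies the sign that cancels the one in the weak
  -- derivative.
  have hφd : ContDiff ℝ ∞ (fun t => ρ (x - t)) := hρd.comp (contDiff_const.sub contDiff_id)
  have hφ : ∀ t, fderiv ℝ (fun t => ρ (x - t)) t e = - fderiv ℝ ρ (x - t) e := by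
    intro t
    have h2 : HasFDerivAt (fun t => ρ (x - t))
        ((fderiv ℝ ρ (x - t)).comp (-(ContinuousLinearMap.id ℝ (Eucl N)))) t :=
      ((hρd.differentiable (by simp)) (x - t)).hasFDerivAt.comp t ((hasFDerivAt_id t).const_sub x)
    rw [h2.fderiv]; simp
  have hts : tsupport (fun t => ρ (x - t)) ⊆ Metric.closedBall x (1 / ((n : ℝ) + 1)) := by
    refine closure_minimal (fun t ht => ?_) Metric.isClosed_closedBall
    have h3 : x - t ∈ Function.support ρ := ht
    rw [hρ, (stdBump N n).support_normed_eq] at h3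
    have h4 : dist (x - t) 0 < 1 / ((n : ℝ) + 1) := h3
    rw [Metric.mem_closedBall, dist_comm, dist_eq_norm]
    simpa using h4.le
  have hφc : HasCompactSupport (fun t => ρ (x - t)) :=
    IsCompact.of_isClosed_subset (isCompact_closedBall _ _) (isClosed_tsupport _) hts
  have h5 := h _ hφd hφc (hts.trans hx)
  have h6 : ∀ (v : Eucl N → ℝ) (q : Eucl N → ℝ),
      ∫ t, v t * q t ∂volOn Ω = ∫ t, q t * Ω.indicator v t := by
    intro v q
    rw [volOn, ← integral_indicator hΩ]
    refine integral_congr_ae (Eventually.of_forall fun t => ?_)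
    by_cases ht : t ∈ Ω <;> simp [ht, mul_comm]
  rw [h6, h6] at h5
  simp_rw [hφ, neg_mul, integral_neg, neg_inj] at h5
  rw [h1, h5, mollify_apply]

/-! ### Truncations -/

lemma abs_trunc_le {k : ℝ} (hk : 0 ≤ k) (s : ℝ) : |trunc k s| ≤ k := by
  rw [trunc, abs_le]
  exact ⟨le_max_left _ _, max_le (by linarith) (min_le_right _ _)⟩

lemma continuous_trunc (k : ℝ) : Continuous (trunc k) :=
  continuous_const.max (continuous_id.min continuous_const)

lemma trunc_of_abs_le {k s : ℝ} (h : |s| ≤ k) : trunc k s = s := by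
  rw [abs_le] at h
  rw [trunc, min_eq_left h.2, max_eq_right h.1]

lemma trunc_of_le {k s : ℝ} (hk : 0 ≤ k) (h : k ≤ s) : trunc k s = k := by
  rw [trunc, min_eq_right h, max_eq_right (by linarith)]

lemma trunc_of_le_neg {k s : ℝ} (h : s ≤ -k) : trunc k s = -k := by
  rw [trunc, max_eq_left ((min_le_left _ _).trans h)]

lemma trunc_neg {k : ℝ} (hk : 0 ≤ k) (s : ℝ) : trunc k (-s) = - trunc k s := by
  simp only [trunc, max_def, min_def]
  split_ifs <;> linarith

lemma abs_trunc_le_abs {k : ℝ} (hk : 0 ≤ k) (s : ℝ) : |trunc k s| ≤ |s| := by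
  rcases le_total (|s|) k with h | h
  · rw [trunc_of_abs_le h]
  · exact (abs_trunc_le hk s).trans h

lemma trunc_nonneg {k s : ℝ} (hk : 0 ≤ k) (hs : 0 ≤ s) : 0 ≤ trunc k s :=
  le_max_of_le_right (le_min hs hk)

lemma trunc_zero {k : ℝ} (hk : 0 ≤ k) : trunc k 0 = 0 := trunc_of_abs_le (by simpa)

lemma tendsto_trunc_nat (s : ℝ) : Tendsto (fun n : ℕ => trunc n s) atTop (𝓝 s) := by
  refine tendsto_const_nhds.congr' ?_
  obtain ⟨m, hm⟩ := exists_nat_ge |s|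
  filter_upwards [eventually_ge_atTop m] with n hn
  exact (trunc_of_abs_le (hm.trans (by exact_mod_cast hn))).symm

/-! ### Weak derivatives -/

lemma tendsto_integral_mul_of_tendsto_integral_abs_sub {α : Type*} [MeasurableSpace α]
    {μ : Measure α} {F : ℕ → α → ℝ} {f q : α → ℝ} {C : ℝ} (hF : ∀ n, Integrable (F n) μ)
    (hf : Integrable f μ) (hq : AEStronglyMeasurable q μ) (hC : ∀ x, |q x| ≤ C)
    (h : Tendsto (fun n => ∫ x, |F n x - f x| ∂μ) atTop (𝓝 0)) :
    Tendsto (fun n => ∫ x, F n x * q x ∂μ) atTop (𝓝 (∫ x, f x * q x ∂μ)) := by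
  have hFq : ∀ n, Integrable (fun x => F n x * q x) μ := fun n =>
    (hF n).mul_bdd (c := C) hq (Eventually.of_forall hC)
  have hfq : Integrable (fun x => f x * q x) μ := hf.mul_bdd (c := C) hq (Eventually.of_forall hC)
  rw [tendsto_iff_norm_sub_tendsto_zero]
  refine squeeze_zero (fun n => norm_nonneg _) (fun n => ?_)
    (g := fun n => C * ∫ x, |F n x - f x| ∂μ) (by simpa using h.const_mul C)
  rw [← integral_sub (hFq n) hfq, ← integral_const_mul]
  refine (norm_integral_le_integral_norm _).trans ?_
  refine integral_mono ((hFq n).sub hfq).norm (((hF n).sub hf).abs.const_mul C) fun x => ?_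
  simp only [Real.norm_eq_abs]
  rw [← sub_mul, abs_mul, mul_comm]
  exact mul_le_mul_of_nonneg_right (hC x) (abs_nonneg _)

lemma exists_bound_fderiv_apply {N : ℕ} {φ : Eucl N → ℝ} (hφ : ContDiff ℝ ∞ φ)
    (hc : HasCompactSupport φ) (e : Eucl N) : ∃ C, ∀ x, |fderiv ℝ φ x e| ≤ C := by
  have h1 : Continuous fun x => fderiv ℝ φ x e :=
    (hφ.continuous_fderiv (by simp)).clm_apply continuous_const
  obtain ⟨C, hC⟩ := (hc.fderiv_apply ℝ e).exists_bound_of_continuous h1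
  exact ⟨C, fun x => hC x⟩

/-- Test functions and their derivatives are bounded, so both sides of the integration by parts pass
to `L¹` limits. -/
lemma HasWeakDeriv.of_tendsto {N : ℕ} {Ω : Set (Eucl N)} {W E : ℕ → Eucl N → ℝ}
    {w d : Eucl N → ℝ} {e : Eucl N} (hW : ∀ n, Integrable (W n) (volOn Ω))
    (hE : ∀ n, Integrable (E n) (volOn Ω)) (hw : Integrable w (volOn Ω))
    (hd : Integrable d (volOn Ω)) (h : ∀ n, HasWeakDeriv Ω (W n) (E n) e)
    (hWw : Tendsto (fun n => ∫ x, |W n x - w x| ∂volOn Ω) atTop (𝓝 0))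
    (hEd : Tendsto (fun n => ∫ x, |E n x - d x| ∂volOn Ω) atTop (𝓝 0)) :
    HasWeakDeriv Ω w d e := by
  intro φ hφ hc hs
  obtain ⟨C, hC⟩ := exists_bound_fderiv_apply hφ hc e
  obtain ⟨C', hC'⟩ := hc.exists_bound_of_continuous hφ.continuous
  have h1 := tendsto_integral_mul_of_tendsto_integral_abs_sub hW hw
    ((hφ.continuous_fderiv (by simp)).clm_apply continuous_const).aestronglyMeasurable hC hWw
  have h2 := tendsto_integral_mul_of_tendsto_integral_abs_sub hE hd
    hφ.continuous.aestronglyMeasurable (fun x => hC' x) hEd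
  refine tendsto_nhds_unique h1 (h2.neg.congr fun n => ?_)
  exact (h n φ hφ hc hs).symm

lemma tendsto_integral_abs_sub_of_bounded {α : Type*} [MeasurableSpace α] {μ : Measure α}
    {F : ℕ → α → ℝ} {f G : α → ℝ} (hF : ∀ n, AEStronglyMeasurable (F n) μ)
    (hf : AEStronglyMeasurable f μ)
    (hG : Integrable G μ) (hle : ∀ n, ∀ᵐ x ∂μ, |F n x| ≤ G x)
    (hFf : ∀ᵐ x ∂μ, Tendsto (fun n => F n x) atTop (𝓝 (f x))) :
    Tendsto (fun n => ∫ x, |F n x - f x| ∂μ) atTop (𝓝 0) := by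
  have hF' : ∀ n, Integrable (F n) μ := fun n => hG.mono' (hF n) (hle n)
  have hf' : Integrable f μ := by
    refine hG.mono' hf ?_
    filter_upwards [ae_all_iff.2 hle, hFf] with x h1 h2
    exact le_of_tendsto' h2.abs h1
  exact tendsto_integral_abs_sub_of_dominated hF' hf' (fun _ => hG) hG hle hFf
    (Eventually.of_forall fun x => tendsto_const_nhds) tendsto_const_nhds

/-- The chain rule for weak derivatives, with a `C¹` outer function. -/
lemma HasWeakDeriv.comp {N : ℕ} {Ω : Set (Eucl N)} (hΩ : IsOpen Ω) {w d : Eucl N → ℝ}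
    {e : Eucl N} (hw : Integrable w (volOn Ω)) (hd : Integrable d (volOn Ω))
    (h : HasWeakDeriv Ω w d e) {F ψ : ℝ → ℝ} (hF0 : F 0 = 0) (hF : ∀ s, HasDerivAt F (ψ s) s)
    (hψ : Continuous ψ) (hψ1 : ∀ s, |ψ s| ≤ 1) :
    HasWeakDeriv Ω (fun x => F (w x)) (fun x => ψ (w x) * d x) e := by
  intro φ hφ hc hs
  have hΩm := hΩ.measurableSet
  set W := Ω.indicator w with hWdef
  set D := Ω.indicator d with hDdef
  have hW : Integrable W := (integrable_indicator_iff hΩm).2 hw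
  have hD : Integrable D := (integrable_indicator_iff hΩm).2 hd
  have hFC : ContDiff ℝ 1 F := by
    rw [contDiff_one_iff_deriv]
    refine ⟨fun s => (hF s).differentiableAt, ?_⟩
    rwa [show deriv F = ψ from funext fun s => (hF s).deriv]
  have hFlip : ∀ s t, |F s - F t| ≤ |s - t| := by
    intro s t
    have := Convex.norm_image_sub_le_of_norm_hasDerivWithin_le (f := F) (f' := ψ) (C := 1)
      (s := univ) (x := t) (y := s) (fun x _ => (hF x).hasDerivWithinAt) (fun x _ => hψ1 x)
      convex_univ (mem_univ _) (mem_univ _)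
    simpa using this
  have hFint : ∀ v : Eucl N → ℝ, Integrable v → Integrable fun x => F (v x) := by
    intro v hv
    refine hv.abs.mono' (hFC.continuous.comp_aestronglyMeasurable hv.aestronglyMeasurable)
      (Eventually.of_forall fun x => ?_)
    simpa [hF0] using hFlip (v x) 0
  obtain ⟨C, hC⟩ := exists_bound_fderiv_apply hφ hc e
  obtain ⟨C', hC'⟩ := hc.exists_bound_of_continuous hφ.continuous
  have hq : Continuous fun x => fderiv ℝ φ x e :=
    (hφ.continuous_fderiv (by simp)).clm_apply continuous_const
  have hconvW := tendsto_integral_abs_mollify_sub hW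
  have hconvD := tendsto_integral_abs_mollify_sub hD
  have hψm : ∀ v : Eucl N → ℝ, Integrable v → AEStronglyMeasurable fun x => ψ (v x) :=
    fun v hv => hψ.comp_aestronglyMeasurable hv.aestronglyMeasurable
  have hψD : ∀ v b : Eucl N → ℝ, Integrable v → Integrable b →
      Integrable fun x => ψ (v x) * b x := fun v b hv hb =>
    hb.bdd_mul (c := 1) (hψm v hv) (Eventually.of_forall fun x => hψ1 _)
  have lim1 : Tendsto (fun n => ∫ x, F (mollify n W x) * fderiv ℝ φ x e) atTop
      (𝓝 (∫ x, F (W x) * fderiv ℝ φ x e)) := by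
    refine tendsto_integral_mul_of_tendsto_integral_abs_sub
      (fun n => hFint _ (integrable_mollify n hW)) (hFint _ hW) hq.aestronglyMeasurable hC ?_
    refine squeeze_zero (fun n => integral_nonneg fun x => abs_nonneg _) (fun n => ?_) hconvW
    exact integral_mono ((hFint _ (integrable_mollify n hW)).sub (hFint _ hW)).abs
      ((integrable_mollify n hW).sub hW).abs fun x => hFlip _ _
  have lim2 : Tendsto (fun n => ∫ x, (ψ (mollify n W x) * mollify n D x) * φ x) atTop
      (𝓝 (∫ x, (ψ (W x) * D x) * φ x)) := by
    refine tendsto_integral_mul_of_tendsto_integral_abs_sub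
      (fun n => hψD _ _ (integrable_mollify n hW) (integrable_mollify n hD)) (hψD _ _ hW hD)
      hφ.continuous.aestronglyMeasurable (fun x => hC' x) ?_
    -- The product is compared through `ψ(W_n) D`: replacing `D_n` by `D` costs at most `|D_n - D|`,
    -- and replacing `ψ(W_n)` by `ψ(W)` is dominated by `|D|`.
    have hA : Tendsto (fun n => ∫ x, |ψ (mollify n W x) * D x - ψ (W x) * D x|) atTop (𝓝 0) := by
      refine tendsto_integral_abs_sub_of_bounded
        (fun n => (hψD _ _ (integrable_mollify n hW) hD).aestronglyMeasurable)
        (hψD _ _ hW hD).aestronglyMeasurable hD.abs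
        (fun n => Eventually.of_forall fun x => ?_) ?_
      · rw [abs_mul]
        exact mul_le_of_le_one_left (abs_nonneg _) (hψ1 _)
      · filter_upwards [ae_tendsto_mollify hW.locallyIntegrable] with x hx
        exact ((hψ.tendsto _).comp hx).mul_const _
    refine squeeze_zero (fun n => integral_nonneg fun x => abs_nonneg _) (fun n => ?_)
      (by simpa using hconvD.add hA)
    have hn1 := hψD _ _ (integrable_mollify n hW) (integrable_mollify n hD)
    have hn2 := hψD _ _ (integrable_mollify n hW) hD
    rw [← integral_add (f := fun x => |mollify n D x - D x|)
      (g := fun x => |ψ (mollify n W x) * D x - ψ (W x) * D x|)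
      ((integrable_mollify n hD).sub hD).abs (hn2.sub (hψD _ _ hW hD)).abs]
    refine integral_mono (hn1.sub (hψD _ _ hW hD)).abs
      (((integrable_mollify n hD).sub hD).abs.add (hn2.sub (hψD _ _ hW hD)).abs) fun x => ?_
    calc |ψ (mollify n W x) * mollify n D x - ψ (W x) * D x|
        = |ψ (mollify n W x) * (mollify n D x - D x)
            + (ψ (mollify n W x) * D x - ψ (W x) * D x)| := by ring_nf
      _ ≤ _ := abs_add_le _ _
      _ ≤ _ := by
        refine add_le_add ?_ le_rfl
        rw [abs_mul]
        exact mul_le_of_le_one_left (abs_nonneg _) (hψ1 _)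
  -- Once the mollification radius is below the distance `δ`, the classical chain rule holds on the
  -- support of `φ`; off it, `φ` kills everything.
  obtain ⟨δ, hδ, hδΩ⟩ := hc.isCompact.exists_cthickening_subset_open hΩ hs
  have hpart : ∀ᶠ n : ℕ in atTop, ∫ x, F (mollify n W x) * fderiv ℝ φ x e
      = - ∫ x, (ψ (mollify n W x) * mollify n D x) * φ x := by
    have h0 : ∀ᶠ n : ℕ in atTop, 1 / ((n : ℝ) + 1) < δ :=
      (tendsto_order.1 tendsto_one_div_add_atTop_nhds_zero_nat).2 δ hδ
    filter_upwards [h0] with n hn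
    have hcd := contDiff_mollify n hW.locallyIntegrable
    have hder : ∀ x, fderiv ℝ (fun x => F (mollify n W x)) x e * φ x
        = (ψ (mollify n W x) * mollify n D x) * φ x := by
      intro x
      by_cases hx : x ∈ tsupport φ
      · have hsub : Metric.closedBall x (1 / ((n : ℝ) + 1)) ⊆ Ω :=
          (Metric.closedBall_subset_closedBall hn.le).trans
            ((Metric.closedBall_subset_cthickening hx δ).trans hδΩ)
        have h1 := fderiv_mollify_apply hΩm hw h n hsub
        have h2 : HasFDerivAt (fun x => F (mollify n W x))
            (ψ (mollify n W x) • fderiv ℝ (mollify n W) x) x :=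
          (hF _).comp_hasFDerivAt x ((hcd.differentiable (by simp)) x).hasFDerivAt
        rw [h2.fderiv, smul_apply, h1, smul_eq_mul]
      · simp [image_eq_zero_of_notMem_tsupport hx]
    have hI := hψD _ _ (integrable_mollify n hW) (integrable_mollify n hD)
    rw [integral_mul_fderiv_eq_neg_fderiv_mul_of_integrable]
    · simp_rw [hder]
    · simp_rw [hder]
      exact hI.mul_bdd (c := C') hφ.continuous.aestronglyMeasurable (Eventually.of_forall hC')
    · exact (hFint _ (integrable_mollify n hW)).mul_bdd (c := C) hq.aestronglyMeasurable
        (Eventually.of_forall hC)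
    · exact (hFint _ (integrable_mollify n hW)).mul_bdd (c := C') hφ.continuous.aestronglyMeasurable
        (Eventually.of_forall hC')
    · exact fun x _ => (hFC.comp hcd).differentiable (by simp) x
    · exact fun x _ => hφ.differentiable (by simp) x
  have key := tendsto_nhds_unique lim1 (lim2.neg.congr' (hpart.mono fun n hn => hn.symm))
  have hz1 : ∀ x ∉ Ω, F (W x) * fderiv ℝ φ x e = 0 := fun x hx => by
    rw [fderiv_of_notMem_tsupport ℝ (fun h => hx (hs h))]; simp
  have hz2 : ∀ x ∉ Ω, (ψ (W x) * D x) * φ x = 0 := fun x hx => by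
    simp [hDdef, hx]
  rw [← setIntegral_eq_integral_of_forall_compl_eq_zero hz1,
    ← setIntegral_eq_integral_of_forall_compl_eq_zero hz2] at key
  rw [volOn]
  convert key using 1
  · exact setIntegral_congr_fun hΩm fun x hx => by simp [hWdef, hx]
  · congr 1
    exact setIntegral_congr_fun hΩm fun x hx => by simp [hWdef, hDdef, hx]

lemma integral_indicator_Ioo_eq_trunc {k : ℝ} (hk : 0 < k) (s : ℝ) :
    ∫ t in (0 : ℝ)..s, (Ioo (-k) k).indicator (fun _ => (1 : ℝ)) t = trunc k s := by
  have hi : ∀ a b : ℝ, IntervalIntegrable ((Ioo (-k) k).indicator (fun _ => (1 : ℝ))) volume a b := by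
    intro a b
    rw [intervalIntegrable_iff]
    exact (integrableOn_const (by simp)).indicator measurableSet_Ioo
  have := integral_eq_of_hasDerivAt_off_countable (trunc k)
    ((Ioo (-k) k).indicator (fun _ => (1 : ℝ))) (a := 0) (b := s) (s := {-k, k})
    (by simp) (continuous_trunc k).continuousOn ?_ (hi 0 s)
  · rw [this, trunc_zero hk.le, sub_zero]
  · rintro x ⟨_, hx⟩
    simp only [mem_insert_iff, mem_singleton_iff, not_or] at hx
    rcases lt_or_gt_of_ne hx.1 with h1 | h1
    · rw [indicator_of_notMem (by simp [h1.le])]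
      refine (hasDerivAt_const x (-k)).congr_of_eventuallyEq ?_
      filter_upwards [gt_mem_nhds h1] with y hy
      exact trunc_of_le_neg hy.le
    rcases lt_or_gt_of_ne hx.2 with h2 | h2
    · rw [indicator_of_mem (show x ∈ Ioo (-k) k from ⟨h1, h2⟩)]
      refine (hasDerivAt_id x).congr_of_eventuallyEq ?_
      filter_upwards [gt_mem_nhds h2, lt_mem_nhds h1] with y hy hy'
      exact trunc_of_abs_le (abs_le.2 ⟨hy'.le, hy.le⟩)
    · rw [indicator_of_notMem (by simp [h2.le])]
      refine (hasDerivAt_const x k).congr_of_eventuallyEq ?_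
      filter_upwards [lt_mem_nhds h2] with y hy
      exact trunc_of_le hk.le hy.le

/-- The chain rule for weak derivatives, with a truncation as outer function. -/
lemma HasWeakDeriv.trunc {N : ℕ} {Ω : Set (Eucl N)} (hΩ : IsOpen Ω) {w d : Eucl N → ℝ}
    {e : Eucl N} (hw : Integrable w (volOn Ω)) (hd : Integrable d (volOn Ω))
    (h : HasWeakDeriv Ω w d e) {k : ℝ} (hk : 0 < k) :
    HasWeakDeriv Ω (fun x => trunc k (w x)) ({x | |w x| < k}.indicator d) e := by
  -- Continuous cutoffs converging to the indicator of the open interval `(-k, k)`. They vanish at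
  -- `|s| = k`, hence the strict inequality in the resulting derivative; their primitives converge
  -- to the truncation.
  set ψ : ℕ → ℝ → ℝ := fun n s => min 1 (max 0 (n * (k - |s|))) with hψdef
  have hψc : ∀ n, Continuous (ψ n) := fun n => by simp only [hψdef]; fun_prop
  have hψ0 : ∀ n s, 0 ≤ ψ n s := fun n s => le_min zero_le_one (le_max_left _ _)
  have hψ1 : ∀ n s, |ψ n s| ≤ 1 := fun n s => by
    rw [abs_of_nonneg (hψ0 n s)]; exact min_le_left _ _
  have hψlim : ∀ s, Tendsto (fun n => ψ n s) atTop
      (𝓝 ((Ioo (-k) k).indicator (fun _ => (1 : ℝ)) s)) := by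
    intro s
    by_cases hs : |s| < k
    · rw [indicator_of_mem (show s ∈ Ioo (-k) k from abs_lt.1 hs)]
      refine tendsto_const_nhds.congr' ?_
      have : 0 < k - |s| := sub_pos.2 hs
      obtain ⟨m, hm⟩ := exists_nat_ge (1 / (k - |s|))
      filter_upwards [eventually_ge_atTop m] with n hn
      have h1 : 1 ≤ n * (k - |s|) := by
        rw [← div_le_iff₀ this]
        exact hm.trans (by exact_mod_cast hn)
      exact (min_eq_left (le_max_of_le_right h1)).symm
    · rw [indicator_of_notMem (show s ∉ Ioo (-k) k from fun h => hs (abs_lt.2 h))]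
      refine tendsto_const_nhds.congr fun n => ?_
      have h1 : n * (k - |s|) ≤ 0 :=
        mul_nonpos_of_nonneg_of_nonpos (Nat.cast_nonneg n) (by linarith [not_lt.1 hs])
      simp [hψdef, max_eq_left h1]
  set F : ℕ → ℝ → ℝ := fun n s => ∫ t in (0 : ℝ)..s, ψ n t with hFdef
  have hF : ∀ n s, HasDerivAt (F n) (ψ n s) s := fun n s =>
    intervalIntegral.integral_hasDerivAt_right ((hψc n).intervalIntegrable _ _)
      ((hψc n).stronglyMeasurableAtFilter _ _) (hψc n).continuousAt
  have hFlim : ∀ s, Tendsto (fun n => F n s) atTop (𝓝 (_root_.trunc k s)) := by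
    intro s
    rw [← integral_indicator_Ioo_eq_trunc hk s]
    refine intervalIntegral.tendsto_integral_filter_of_dominated_convergence (fun _ => 1)
      (Eventually.of_forall fun n => (hψc n).aestronglyMeasurable)
      (Eventually.of_forall fun n => Eventually.of_forall fun t _ => hψ1 n t)
      (by simp) (Eventually.of_forall fun t _ => hψlim t)
  have hFle : ∀ n s, |F n s| ≤ |s| := fun n s => by
    have := intervalIntegral.norm_integral_le_of_norm_le_const (a := 0) (b := s) (f := ψ n)
      (C := 1) (fun x _ => hψ1 n x)
    simpa using this
  have hFc : ∀ n, Continuous (F n) := fun n =>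
    continuous_iff_continuousAt.2 fun s => (hF n s).continuousAt
  have hlim2 : ∀ x, Tendsto (fun n => ψ n (w x) * d x) atTop
      (𝓝 ({x | |w x| < k}.indicator d x)) := by
    intro x
    have := (hψlim (w x)).mul_const (d x)
    convert this using 2
    by_cases hx : |w x| < k
    · rw [indicator_of_mem (show x ∈ {x | |w x| < k} from hx),
        indicator_of_mem (show w x ∈ Ioo (-k) k from abs_lt.1 hx),
        one_mul]
    · rw [indicator_of_notMem (show x ∉ {x | |w x| < k} from hx),
        indicator_of_notMem (show w x ∉ Ioo (-k) k from fun h => hx (abs_lt.2 h)), zero_mul]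
  have hm1 : ∀ n, AEStronglyMeasurable (fun x => F n (w x)) (volOn Ω) := fun n =>
    (hFc n).comp_aestronglyMeasurable hw.aestronglyMeasurable
  have hm2 : ∀ n, AEStronglyMeasurable (fun x => ψ n (w x) * d x) (volOn Ω) := fun n =>
    ((hψc n).comp_aestronglyMeasurable hw.aestronglyMeasurable).mul hd.aestronglyMeasurable
  have hm3 : AEStronglyMeasurable (fun x => _root_.trunc k (w x)) (volOn Ω) :=
    (continuous_trunc k).comp_aestronglyMeasurable hw.aestronglyMeasurable
  have hm4 : AEStronglyMeasurable ({x | |w x| < k}.indicator d) (volOn Ω) :=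
    aestronglyMeasurable_of_tendsto_ae atTop hm2 (Eventually.of_forall hlim2)
  have hb : ∀ n x, |ψ n (w x) * d x| ≤ |d x| := fun n x => by
    rw [abs_mul]; exact mul_le_of_le_one_left (abs_nonneg _) (hψ1 n _)
  refine HasWeakDeriv.of_tendsto (W := fun n x => F n (w x)) (E := fun n x => ψ n (w x) * d x)
    (fun n => hw.abs.mono' (hm1 n) (Eventually.of_forall fun x => hFle n _))
    (fun n => hd.abs.mono' (hm2 n) (Eventually.of_forall fun x => hb n x))
    (hw.abs.mono' hm3 (Eventually.of_forall fun x => abs_trunc_le_abs hk.le _))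
    (hd.abs.mono' hm4 (Eventually.of_forall fun x => norm_indicator_le_norm_self d x))
    (fun n => h.comp hΩ hw hd (by simp [hFdef]) (hF n) (hψc n) (hψ1 n)) ?_ ?_
  · exact tendsto_integral_abs_sub_of_bounded hm1 hm3 hw.abs
      (fun n => Eventually.of_forall fun x => hFle n _) (Eventually.of_forall fun x => hFlim _)
  · exact tendsto_integral_abs_sub_of_bounded hm2 hm4 hd.abs
      (fun n => Eventually.of_forall fun x => hb n x) (Eventually.of_forall hlim2)

lemma isFiniteMeasure_volOn {N : ℕ} {Ω : Set (Eucl N)} (hΩ : Bornology.IsBounded Ω) :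
    IsFiniteMeasure (volOn Ω) :=
  ⟨by rw [volOn, Measure.restrict_apply_univ]; exact hΩ.measure_lt_top⟩

/-! ### Sobolev gradients -/

lemma one_le_ofReal {p : ℝ} (hp : 1 < p) : 1 ≤ ENNReal.ofReal p := by
  rw [← ENNReal.ofReal_one]; exact ENNReal.ofReal_le_ofReal hp.le

lemma HasSobolevGradient.hasWeakDeriv {N : ℕ} {Ω : Set (Eucl N)} {p : ℝ} {w : Eucl N → ℝ}
    {D : Eucl N → Eucl N} (h : HasSobolevGradient Ω p w D) (e : Eucl N) :
    HasWeakDeriv Ω w (fun x => inner ℝ (D x) e) e :=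
  fun φ h1 h2 h3 => h.integral_eq φ h1 h2 h3 e

lemma HasSobolevGradient.integrable {N : ℕ} {Ω : Set (Eucl N)} (hΩb : Bornology.IsBounded Ω)
    {p : ℝ} (hp : 1 < p) {w : Eucl N → ℝ} {D : Eucl N → Eucl N}
    (h : HasSobolevGradient Ω p w D) : Integrable w (volOn Ω) :=
  have := isFiniteMeasure_volOn hΩb
  h.memLp.integrable (one_le_ofReal hp)

lemma HasSobolevGradient.integrable_grad {N : ℕ} {Ω : Set (Eucl N)}
    (hΩb : Bornology.IsBounded Ω) {p : ℝ} (hp : 1 < p) {w : Eucl N → ℝ} {D : Eucl N → Eucl N}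
    (h : HasSobolevGradient Ω p w D) : Integrable D (volOn Ω) :=
  have := isFiniteMeasure_volOn hΩb
  h.memLp_grad.integrable (one_le_ofReal hp)

lemma HasSobolevGradient.congr {N : ℕ} {Ω : Set (Eucl N)} {p : ℝ} {w w' : Eucl N → ℝ}
    {D D' : Eucl N → Eucl N} (h : HasSobolevGradient Ω p w D) (hw : w =ᵐ[volOn Ω] w')
    (hD : D =ᵐ[volOn Ω] D') : HasSobolevGradient Ω p w' D' where
  memLp := (memLp_congr_ae hw).1 h.memLp
  memLp_grad := (memLp_congr_ae hD).1 h.memLp_grad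
  integral_eq φ h1 h2 h3 e := by
    have h4 : ∫ x, w x * fderiv ℝ φ x e ∂volOn Ω = ∫ x, w' x * fderiv ℝ φ x e ∂volOn Ω :=
      integral_congr_ae (hw.mono fun x hx => by simp only [hx])
    have h5 : ∫ x, inner ℝ (D x) e * φ x ∂volOn Ω = ∫ x, inner ℝ (D' x) e * φ x ∂volOn Ω :=
      integral_congr_ae (hD.mono fun x hx => by simp only [hx])
    rw [← h4, h.integral_eq φ h1 h2 h3 e, h5]

lemma HasSobolevGradient.sub {N : ℕ} {Ω : Set (Eucl N)} (hΩb : Bornology.IsBounded Ω) {p : ℝ}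
    (hp : 1 < p) {w w' : Eucl N → ℝ} {D D' : Eucl N → Eucl N}
    (h : HasSobolevGradient Ω p w D) (h' : HasSobolevGradient Ω p w' D') :
    HasSobolevGradient Ω p (fun x => w x - w' x) (fun x => D x - D' x) where
  memLp := h.memLp.sub h'.memLp
  memLp_grad := h.memLp_grad.sub h'.memLp_grad
  integral_eq φ h1 h2 h3 e := by
    obtain ⟨C, hC⟩ := exists_bound_fderiv_apply h1 h2 e
    obtain ⟨C', hC'⟩ := h2.exists_bound_of_continuous h1.continuous
    have hq : Continuous fun x => fderiv ℝ φ x e :=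
      (h1.continuous_fderiv (by simp)).clm_apply continuous_const
    have hi : ∀ v : Eucl N → ℝ, Integrable v (volOn Ω) →
        Integrable (fun x => v x * fderiv ℝ φ x e) (volOn Ω) := fun v hv =>
      hv.mul_bdd (c := C) hq.aestronglyMeasurable (Eventually.of_forall hC)
    have hi' : ∀ E : Eucl N → Eucl N, Integrable E (volOn Ω) →
        Integrable (fun x => inner ℝ (E x) e * φ x) (volOn Ω) := fun E hE =>
      (hE.inner_const e).mul_bdd (c := C') h1.continuous.aestronglyMeasurable
        (Eventually.of_forall hC')
    simp_rw [sub_mul, inner_sub_left, sub_mul]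
    rw [integral_sub (hi _ (h.integrable hΩb hp)) (hi _ (h'.integrable hΩb hp)),
      integral_sub (hi' _ (h.integrable_grad hΩb hp)) (hi' _ (h'.integrable_grad hΩb hp)),
      h.integral_eq φ h1 h2 h3 e, h'.integral_eq φ h1 h2 h3 e]
    ring

/-- Weak gradients are unique. -/
lemma HasSobolevGradient.ae_eq {N : ℕ} {Ω : Set (Eucl N)} (hΩ : IsOpen Ω)
    (hΩb : Bornology.IsBounded Ω) {p : ℝ}
    (hp : 1 < p) {w : Eucl N → ℝ} {D D' : Eucl N → Eucl N}
    (h : HasSobolevGradient Ω p w D) (h' : HasSobolevGradient Ω p w D') :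
    D =ᵐ[volOn Ω] D' := by
  have hs := h.sub hΩb hp h'
  have hint : Integrable (fun x => D x - D' x) (volOn Ω) := hs.integrable_grad hΩb hp
  have key : ∀ᵐ x, x ∈ Ω → D x - D' x = 0 := by
    refine hΩ.ae_eq_zero_of_integral_contDiff_smul_eq_zero ?_ fun φ h1 h2 h3 => ?_
    · exact IntegrableOn.locallyIntegrableOn hint
    · obtain ⟨C', hC'⟩ := h2.exists_bound_of_continuous h1.continuous
      have hφi : Integrable (fun x => φ x • (D x - D' x)) (volOn Ω) :=
        hint.bdd_smul C' h1.continuous.aestronglyMeasurable (Eventually.of_forall hC')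
      have hz : ∀ x ∉ Ω, φ x • (D x - D' x) = 0 := fun x hx => by
        rw [image_eq_zero_of_notMem_tsupport fun h => hx (h3 h), zero_smul]
      rw [← setIntegral_eq_integral_of_forall_compl_eq_zero hz]
      refine ext_inner_right ℝ fun e => ?_
      rw [inner_zero_left, real_inner_comm]
      have h4 := integral_inner (𝕜 := ℝ) hφi e
      rw [volOn] at h4
      rw [← h4]
      -- `hs` concerns the function `w - w = 0`, so the side without derivatives drops out.
      have h5 := hs.integral_eq φ h1 h2 h3 e
      simp only [sub_self, zero_mul, integral_zero] at h5
      rw [eq_comm, neg_eq_zero, volOn] at h5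
      rw [← h5]
      refine integral_congr_ae (Eventually.of_forall fun x => ?_)
      simp only [inner_smul_right, real_inner_comm e, mul_comm]
  rw [EventuallyEq, volOn, ae_restrict_iff' hΩ.measurableSet]
  filter_upwards [key] with x hx hxΩ
  exact sub_eq_zero.1 (hx hxΩ)

/-- The gradient of a truncation. -/
lemma HasSobolevGradient.trunc {N : ℕ} {Ω : Set (Eucl N)} (hΩ : IsOpen Ω)
    (hΩb : Bornology.IsBounded Ω) {p : ℝ} (hp : 1 < p) {w : Eucl N → ℝ} {D : Eucl N → Eucl N}
    (h : HasSobolevGradient Ω p w D) {k : ℝ} (hk : 0 < k) :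
    HasSobolevGradient Ω p (fun x => trunc k (w x)) ({x | |w x| < k}.indicator D) where
  memLp := h.memLp.of_le ((continuous_trunc k).comp_aestronglyMeasurable
    h.memLp.aestronglyMeasurable) (Eventually.of_forall fun x => abs_trunc_le_abs hk.le _)
  memLp_grad := by
    refine h.memLp_grad.of_le ?_ (Eventually.of_forall fun x => norm_indicator_le_norm_self D x)
    refine h.memLp_grad.aestronglyMeasurable.indicator₀ ?_
    exact nullMeasurableSet_lt h.memLp.aestronglyMeasurable.aemeasurable.abs aemeasurable_const
  integral_eq φ h1 h2 h3 e := by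
    rw [(h.hasWeakDeriv e).trunc hΩ (h.integrable hΩb hp)
      ((h.integrable_grad hΩb hp).inner_const e) hk φ h1 h2 h3]
    congr 1
    refine integral_congr_ae (Eventually.of_forall fun x => ?_)
    by_cases hx : x ∈ {x | |w x| < k}
    · simp only [indicator_of_mem hx]
    · simp only [indicator_of_notMem hx, inner_zero_left]

/-! ### Functions with vanishing weak gradient -/

/-- A function with zero weak derivatives is constant near every point. -/
lemma exists_ball_ae_eq_const {N : ℕ} {Ω : Set (Eucl N)} (hΩ : IsOpen Ω) {w : Eucl N → ℝ}
    (hw : Integrable w (volOn Ω)) (h : ∀ e, HasWeakDeriv Ω w 0 e) {x₀ : Eucl N} (hx₀ : x₀ ∈ Ω) :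
    ∃ R > 0, ∃ c, Metric.ball x₀ R ⊆ Ω ∧ ∀ᵐ x, x ∈ Metric.ball x₀ R → w x = c := by
  obtain ⟨R, hR, hRΩ⟩ := Metric.isOpen_iff.1 hΩ x₀ hx₀
  have hW : Integrable (Ω.indicator w) := (integrable_indicator_iff hΩ.measurableSet).2 hw
  have hsub : Metric.ball x₀ (R / 2) ⊆ Ω :=
    (Metric.ball_subset_ball (by linarith)).trans hRΩ
  -- Halving the radius leaves room for the mollifier: on the smaller ball the mollifications are
  -- smooth with zero derivative. One point of convergence then fixes the constant.
  have hconst : ∀ᶠ n : ℕ in atTop, ∀ x ∈ Metric.ball x₀ (R / 2), ∀ y ∈ Metric.ball x₀ (R / 2),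
      mollify n (Ω.indicator w) x = mollify n (Ω.indicator w) y := by
    have h0 : ∀ᶠ n : ℕ in atTop, 1 / ((n : ℝ) + 1) < R / 2 :=
      (tendsto_order.1 tendsto_one_div_add_atTop_nhds_zero_nat).2 _ (by linarith)
    filter_upwards [h0] with n hn x hx y hy
    have hd := (contDiff_mollify n hW.locallyIntegrable).differentiable (by simp)
    refine Metric.isOpen_ball.is_const_of_fderiv_eq_zero (𝕜 := ℝ)
      (convex_ball x₀ (R / 2)).isPreconnected hd.differentiableOn (fun z hz => ?_) hx hy
    ext e
    rw [fderiv_mollify_apply hΩ.measurableSet hw (h e) n, mollify_apply]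
    · simp
    · refine (fun t ht => hRΩ ?_)
      rw [Metric.mem_closedBall] at ht
      rw [Metric.mem_ball] at hz ⊢
      linarith [dist_triangle t z x₀]
  have hae := ae_tendsto_mollify hW.locallyIntegrable
  obtain ⟨y, hy, hyt⟩ : ∃ y ∈ Metric.ball x₀ (R / 2),
      Tendsto (fun n => mollify n (Ω.indicator w) y) atTop (𝓝 (Ω.indicator w y)) := by
    have : ∃ᵐ y, y ∈ Metric.ball x₀ (R / 2) := by
      rw [frequently_ae_mem_iff]
      exact (Metric.measure_ball_pos volume x₀ (by linarith)).ne'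
    obtain ⟨y, h1, h2⟩ := (this.and_eventually hae).exists
    exact ⟨y, h1, h2⟩
  refine ⟨R / 2, by linarith, Ω.indicator w y, hsub, ?_⟩
  filter_upwards [hae] with x hx hxb
  have h1 : Tendsto (fun n => mollify n (Ω.indicator w) x) atTop (𝓝 (Ω.indicator w y)) :=
    hyt.congr' (hconst.mono fun n hn => hn y hy x hxb)
  have := tendsto_nhds_unique hx h1
  rwa [indicator_of_mem (hsub hxb)] at this

/-- A function with zero weak derivatives is constant on connected open sets. -/
lemma exists_ae_eq_const {N : ℕ} {Ω : Set (Eucl N)} (hΩ : IsOpen Ω) {w : Eucl N → ℝ}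
    (hw : Integrable w (volOn Ω)) (h : ∀ e, HasWeakDeriv Ω w 0 e) {C : Set (Eucl N)}
    (hC : IsPreconnected C) (hCo : IsOpen C) (hCΩ : C ⊆ Ω) :
    ∃ c, ∀ᵐ x ∂volume.restrict C, w x = c := by
  choose! R hR c hRΩ hc using fun x₀ (hx : x₀ ∈ Ω) => exists_ball_ae_eq_const hΩ hw h hx
  rcases C.eq_empty_or_nonempty with rfl | ⟨z, hz⟩
  · exact ⟨0, by simp⟩
  -- Overlapping balls meet in a set of positive measure, so their constants agree and `c` is
  -- locally constant.
  have hloc : ∀ x ∈ Ω, ∀ y ∈ Metric.ball x (R x), c y = c x := by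
    intro x hx y hy
    have hyΩ := hRΩ x hx hy
    have : ∃ᵐ t, t ∈ Metric.ball x (R x) ∩ Metric.ball y (R y) := by
      rw [frequently_ae_mem_iff]
      exact ((Metric.isOpen_ball.inter Metric.isOpen_ball).measure_pos volume
        ⟨y, hy, Metric.mem_ball_self (hR y hyΩ)⟩).ne'
    obtain ⟨t, ⟨h1, h2⟩, h3, h4⟩ := (this.and_eventually ((hc x hx).and (hc y hyΩ))).exists
    rw [← h3 h1, ← h4 h2]
  have hcc : ∀ x ∈ C, c x = c z := by
    have : PreconnectedSpace C := isPreconnected_iff_preconnectedSpace.1 hC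
    have hl : IsLocallyConstant (fun x : C => c x) := by
      rw [IsLocallyConstant.iff_eventually_eq]
      intro x
      have h1 : ∀ᶠ y in 𝓝 (x : Eucl N), y ∈ Metric.ball (x : Eucl N) (R x) :=
        Metric.ball_mem_nhds _ (hR x (hCΩ x.2))
      have h2 : ∀ᶠ y : C in 𝓝 x, (y : Eucl N) ∈ Metric.ball (x : Eucl N) (R x) :=
        continuous_subtype_val.continuousAt.eventually h1
      exact h2.mono fun y hy => hloc x (hCΩ x.2) y hy
    intro x hx
    exact hl.apply_eq_of_isPreconnected isPreconnected_univ (x := ⟨x, hx⟩) (y := ⟨z, hz⟩)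
      (mem_univ _) (mem_univ _)
  refine ⟨c z, ?_⟩
  rw [ae_restrict_iff' hCo.measurableSet, ae_iff]
  refine measure_null_of_locally_null _ fun x hx => ?_
  simp only [mem_ofPred_eq, Classical.not_imp] at hx
  refine ⟨Metric.ball x (R x) ∩ {a | ¬ (a ∈ C → w a = c z)},
    inter_mem (mem_nhdsWithin_of_mem_nhds (Metric.ball_mem_nhds _ (hR x (hCΩ hx.1))))
      self_mem_nhdsWithin, ?_⟩
  have h1 := hc x (hCΩ hx.1)
  rw [ae_iff] at h1
  refine measure_mono_null ?_ h1
  rintro a ⟨ha, hb⟩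
  simp only [mem_ofPred_eq, Classical.not_imp] at hb ⊢
  exact ⟨ha, by rw [hcc x hx.1]; exact hb.2⟩

/-! ### Traces -/

lemma volume_inter_ball_pos {N : ℕ} {Ω : Set (Eucl N)} (hΩ : IsOpen Ω) {x : Eucl N}
    (hx : x ∈ frontier Ω) {r : ℝ} (hr : 0 < r) : 0 < volume (Ω ∩ Metric.ball x r) := by
  refine (hΩ.inter Metric.isOpen_ball).measure_pos volume ?_
  rw [inter_comm]
  exact mem_closure_iff_nhds.1 hx.1 _ (Metric.ball_mem_nhds x hr)

lemma volume_inter_ball_lt_top {N : ℕ} (Ω : Set (Eucl N)) (x : Eucl N) (r : ℝ) :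
    volume (Ω ∩ Metric.ball x r) < ⊤ :=
  (measure_mono inter_subset_right).trans_lt measure_ball_lt_top

lemma integrableOn_abs_sub_const {N : ℕ} {Ω : Set (Eucl N)} {v : Eucl N → ℝ}
    (hv : Integrable v (volOn Ω)) (t : ℝ) (x : Eucl N) (r : ℝ) :
    IntegrableOn (fun y => |v y - t|) (Ω ∩ Metric.ball x r) :=
  ((IntegrableOn.mono_set hv inter_subset_left).sub
    (integrableOn_const (volume_inter_ball_lt_top Ω x r).ne)).abs

/-- A constant is its own mean over `Ω ∩ B(x, r)`, which has positive measure, so a lower bound near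
`x` by two expressions with vanishing means must be nonpositive. Uniqueness and sign of traces, and
the vanishing of the constant on a component, are all read off from this. -/
lemma le_zero_of_tendsto_average {N : ℕ} {Ω : Set (Eucl N)} (hΩ : IsOpen Ω) {x : Eucl N}
    (hx : x ∈ frontier Ω) {v v' : Eucl N → ℝ} {s s' c : ℝ} (hv : Integrable v (volOn Ω))
    (hv' : Integrable v' (volOn Ω))
    (h : Tendsto (fun r : ℝ => ⨍ y in Ω ∩ Metric.ball x r, |v y - s|) (𝓝[>] 0) (𝓝 0))
    (h' : Tendsto (fun r : ℝ => ⨍ y in Ω ∩ Metric.ball x r, |v' y - s'|) (𝓝[>] 0) (𝓝 0))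
    (hc : ∀ᶠ r in 𝓝[>] (0 : ℝ), ∀ᵐ y ∂volume.restrict (Ω ∩ Metric.ball x r),
      c ≤ |v y - s| + |v' y - s'|) : c ≤ 0 := by
  refine ge_of_tendsto (by simpa using h.add h') ?_
  filter_upwards [hc, self_mem_nhdsWithin] with r hr hr0
  have hpos := volume_inter_ball_pos hΩ hx hr0
  have hfin := volume_inter_ball_lt_top Ω x r
  have hreal : 0 < volume.real (Ω ∩ Metric.ball x r) := ENNReal.toReal_pos hpos.ne' hfin.ne
  have h1 : c = ⨍ _ in Ω ∩ Metric.ball x r, c := (setAverage_const hpos.ne' hfin.ne c).symm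
  rw [h1, setAverage_eq, setAverage_eq, setAverage_eq, ← smul_add,
    ← integral_add (integrableOn_abs_sub_const hv s x r) (integrableOn_abs_sub_const hv' s' x r)]
  refine smul_le_smul_of_nonneg_left ?_ (by positivity)
  exact integral_mono_ae (integrableOn_const hfin.ne)
    ((integrableOn_abs_sub_const hv s x r).add (integrableOn_abs_sub_const hv' s' x r)) hr

lemma ae_mem_surfOn_frontier {N : ℕ} (S : Set (Eucl N)) :
    ∀ᵐ x ∂surfOn (frontier S), x ∈ frontier S :=
  ae_restrict_mem isClosed_frontier.measurableSet

lemma ae_restrict_inter_of_ae_volOn {N : ℕ} {Ω : Set (Eucl N)} {P : Eucl N → Prop}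
    (h : ∀ᵐ y ∂volOn Ω, P y) (s : Set (Eucl N)) : ∀ᵐ y ∂volume.restrict (Ω ∩ s), P y :=
  ae_restrict_of_ae_restrict_of_subset inter_subset_left h

/-- Traces are unique. -/
lemma IsTrace.ae_eq {N : ℕ} {Ω : Set (Eucl N)} (hΩ : IsOpen Ω) {v v' τ τ' : Eucl N → ℝ}
    (hv : Integrable v (volOn Ω)) (hvv : v =ᵐ[volOn Ω] v') (h : IsTrace Ω v τ)
    (h' : IsTrace Ω v' τ') : τ =ᵐ[surfOn (frontier Ω)] τ' := by
  have hv' : Integrable v' (volOn Ω) := hv.congr hvv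
  filter_upwards [h, h', ae_mem_surfOn_frontier Ω] with x h1 h2 hx
  have := le_zero_of_tendsto_average hΩ hx (c := |τ x - τ' x|) hv hv' h1 h2
    (Eventually.of_forall fun r => ?_)
  · exact sub_eq_zero.1 (abs_nonpos_iff.1 this)
  · filter_upwards [ae_restrict_inter_of_ae_volOn hvv (Metric.ball x r)] with y hy
    rw [← hy, abs_sub_comm (v y) (τ x)]
    exact abs_sub_le _ _ _

lemma IsTrace.ae_nonneg {N : ℕ} {Ω : Set (Eucl N)} (hΩ : IsOpen Ω) {v τ : Eucl N → ℝ}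
    (hv : Integrable v (volOn Ω)) (hv0 : ∀ᵐ x ∂volOn Ω, 0 ≤ v x) (h : IsTrace Ω v τ) :
    ∀ᵐ x ∂surfOn (frontier Ω), 0 ≤ τ x := by
  filter_upwards [h, ae_mem_surfOn_frontier Ω] with x h1 hx
  have := le_zero_of_tendsto_average hΩ hx (c := - τ x) hv hv h1 h1
    (Eventually.of_forall fun r => ?_)
  · linarith
  · filter_upwards [ae_restrict_inter_of_ae_volOn hv0 (Metric.ball x r)] with y hy
    have := le_abs_self (v y - τ x)
    have := abs_nonneg (v y - τ x)
    linarith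

lemma measurable_setIntegral_ball {N : ℕ} {V : Eucl N → ℝ} (hV : Measurable V) (r : ℝ) :
    Measurable fun x => ∫ y in Metric.ball x r, V y := by
  have h1 : StronglyMeasurable (Function.uncurry fun x y : Eucl N =>
      (Metric.ball x r).indicator V y) := by
    have h2 : (Function.uncurry fun x y : Eucl N => (Metric.ball x r).indicator V y)
        = {q : Eucl N × Eucl N | dist q.2 q.1 < r}.indicator (fun q => V q.2) := by
      ext ⟨x, y⟩
      simp [Function.uncurry, indicator, Metric.mem_ball]
    rw [h2]
    refine ((hV.comp measurable_snd).indicator ?_).stronglyMeasurable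
    exact measurableSet_lt (measurable_snd.dist measurable_fst) measurable_const
  have h3 := (h1.integral_prod_right (ν := (volume : Measure (Eucl N)))).measurable
  simp_rw [integral_indicator Metric.isOpen_ball.measurableSet] at h3
  exact h3

lemma measurable_average_inter_ball {N : ℕ} {Ω : Set (Eucl N)} (hΩ : MeasurableSet Ω)
    {v : Eucl N → ℝ} (hv : AEMeasurable v (volOn Ω)) (r : ℝ) :
    Measurable fun x => ⨍ y in Ω ∩ Metric.ball x r, v y := by
  have key : ∀ V : Eucl N → ℝ, Measurable V →
      Measurable fun x => ∫ y in Ω ∩ Metric.ball x r, V y := by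
    intro V hV
    have := measurable_setIntegral_ball (hV.indicator hΩ) r
    simp_rw [setIntegral_indicator hΩ] at this
    simpa only [inter_comm] using this
  have h1 : ∀ x, ⨍ y in Ω ∩ Metric.ball x r, v y
      = (∫ _ in Ω ∩ Metric.ball x r, (1 : ℝ))⁻¹ • ∫ y in Ω ∩ Metric.ball x r, hv.mk v y := by
    intro x
    rw [setAverage_eq]
    congr 1
    · simp
    · exact integral_congr_ae (ae_restrict_inter_of_ae_volOn hv.ae_eq_mk _)
  simp_rw [h1]
  exact (key _ measurable_const).inv.smul (key _ hv.measurable_mk)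

/-- Almost everywhere, the trace is the limit of the means over balls of radius `1 / (n + 1)`, and
these are measurable in the centre. -/
lemma IsTrace.aemeasurable {N : ℕ} {Ω : Set (Eucl N)} (hΩ : IsOpen Ω) {v τ : Eucl N → ℝ}
    (hv : Integrable v (volOn Ω)) (h : IsTrace Ω v τ) :
    AEMeasurable τ (surfOn (frontier Ω)) := by
  refine aemeasurable_of_tendsto_metrizable_ae' (fun n : ℕ =>
    (measurable_average_inter_ball hΩ.measurableSet hv.aemeasurable
      (1 / ((n : ℝ) + 1))).aemeasurable) ?_
  filter_upwards [h, ae_mem_surfOn_frontier Ω] with x h1 hx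
  have hr : Tendsto (fun n : ℕ => 1 / ((n : ℝ) + 1)) atTop (𝓝[>] 0) :=
    tendsto_nhdsWithin_iff.2 ⟨tendsto_one_div_add_atTop_nhds_zero_nat,
      Eventually.of_forall fun n => by simp only [mem_Ioi]; positivity⟩
  rw [tendsto_iff_norm_sub_tendsto_zero]
  refine squeeze_zero (fun n => norm_nonneg _) (fun n => ?_) (h1.comp hr)
  have hn : (0 : ℝ) < 1 / ((n : ℝ) + 1) := by positivity
  have hpos := volume_inter_ball_pos hΩ hx hn
  have hfin := volume_inter_ball_lt_top Ω x (1 / ((n : ℝ) + 1))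
  have h2 : τ x = ⨍ _ in Ω ∩ Metric.ball x (1 / ((n : ℝ) + 1)), τ x :=
    (setAverage_const hpos.ne' hfin.ne _).symm
  conv_lhs => rw [h2]
  simp only [Function.comp, setAverage_eq]
  rw [← smul_sub, ← integral_sub (IntegrableOn.mono_set hv inter_subset_left)
    (integrableOn_const hfin.ne), norm_smul, Real.norm_of_nonneg (by positivity)]
  exact mul_le_mul_of_nonneg_left (norm_integral_le_integral_norm _) (by positivity)

lemma integrable_trunc {N : ℕ} {Ω : Set (Eucl N)} (hΩb : Bornology.IsBounded Ω)
    {u : Eucl N → ℝ} (hu : AEMeasurable u (volOn Ω)) {k : ℝ} (hk : 0 ≤ k) :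
    Integrable (fun x => trunc k (u x)) (volOn Ω) := by
  have := isFiniteMeasure_volOn hΩb
  exact Integrable.of_bound ((continuous_trunc k).measurable.comp_aemeasurable
    hu).aestronglyMeasurable k (Eventually.of_forall fun x => abs_trunc_le hk _)

lemma eq_of_forall_trunc_eq {s t : ℝ} (h : ∀ n : ℕ, trunc (n + 1) s = trunc (n + 1) t) :
    s = t := by
  obtain ⟨n, hn⟩ := exists_nat_ge (max |s| |t|)
  have := h n
  rwa [trunc_of_abs_le (by linarith [le_max_left |s| |t|]),
    trunc_of_abs_le (by linarith [le_max_right |s| |t|])] at this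

lemma IsTruncTrace.ae_eq {N : ℕ} {Ω : Set (Eucl N)} (hΩ : IsOpen Ω)
    (hΩb : Bornology.IsBounded Ω) {u u' w w' : Eucl N → ℝ}
    (hu : AEMeasurable u (volOn Ω)) (huu : u =ᵐ[volOn Ω] u') (h : IsTruncTrace Ω u w)
    (h' : IsTruncTrace Ω u' w') : w =ᵐ[surfOn (frontier Ω)] w' := by
  have h1 : ∀ᵐ x ∂surfOn (frontier Ω), ∀ n : ℕ, trunc (n + 1) (w x) = trunc (n + 1) (w' x) := by
    rw [ae_all_iff]
    intro n
    have hn : (0 : ℝ) < n + 1 := by positivity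
    exact (h _ hn).ae_eq hΩ (integrable_trunc hΩb hu hn.le)
      (huu.mono fun x hx => by simp only [hx]) (h' _ hn)
  filter_upwards [h1] with x hx using eq_of_forall_trunc_eq hx

lemma IsTruncTrace.aemeasurable {N : ℕ} {Ω : Set (Eucl N)} (hΩ : IsOpen Ω)
    (hΩb : Bornology.IsBounded Ω) {u w : Eucl N → ℝ}
    (hu : AEMeasurable u (volOn Ω)) (h : IsTruncTrace Ω u w) :
    AEMeasurable w (surfOn (frontier Ω)) := by
  refine aemeasurable_of_tendsto_metrizable_ae' (f := fun (n : ℕ) x => trunc ((n + 1 : ℕ) : ℝ) (w x))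
    (fun n => ?_) (Eventually.of_forall fun x =>
      (tendsto_trunc_nat (w x)).comp (tendsto_add_atTop_nat 1))
  have hn : (0 : ℝ) < ((n + 1 : ℕ) : ℝ) := by positivity
  exact (h _ hn).aemeasurable hΩ (integrable_trunc hΩb hu hn.le)

lemma IsTruncTrace.ae_nonneg {N : ℕ} {Ω : Set (Eucl N)} (hΩ : IsOpen Ω)
    (hΩb : Bornology.IsBounded Ω) {u w : Eucl N → ℝ}
    (hu : AEMeasurable u (volOn Ω)) (hu0 : ∀ᵐ x ∂volOn Ω, 0 ≤ u x) (h : IsTruncTrace Ω u w) :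
    ∀ᵐ x ∂surfOn (frontier Ω), 0 ≤ w x := by
  have h1 := (h 1 one_pos).ae_nonneg hΩ (integrable_trunc hΩb hu zero_le_one)
    (hu0.mono fun x hx => trunc_nonneg zero_le_one hx)
  filter_upwards [h1] with x hx
  by_contra hlt
  push Not at hlt
  have h2 : trunc 1 (w x) < 0 := by
    rw [trunc, max_lt_iff]
    exact ⟨by norm_num, (min_le_left _ _).trans_lt hlt⟩
  linarith

/-! ### Components of Lipschitz domains -/

/-- A frontier point inside `Ω` would have its own open component, which meets the given one and so
equals it; but an open set misses its frontier. -/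
lemma frontier_connectedComponentIn_subset {N : ℕ} {Ω : Set (Eucl N)} (hΩ : IsOpen Ω)
    (x₀ : Eucl N) : frontier (connectedComponentIn Ω x₀) ⊆ frontier Ω := by
  intro x hx
  refine ⟨closure_mono (connectedComponentIn_subset Ω x₀) hx.1, ?_⟩
  rw [hΩ.interior_eq]
  intro hxΩ
  have hopen : IsOpen (connectedComponentIn Ω x) := hΩ.connectedComponentIn
  obtain ⟨y, hy1, hy2⟩ := mem_closure_iff.1 hx.1 _ hopen (mem_connectedComponentIn hxΩ)
  have hxy : connectedComponentIn Ω x₀ = connectedComponentIn Ω x :=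
    (connectedComponentIn_eq hy2).trans (connectedComponentIn_eq hy1).symm
  refine hx.2 ?_
  rw [hΩ.connectedComponentIn.interior_eq, hxy]
  exact mem_connectedComponentIn hxΩ

/-- Points of `Ω` near `x` are lifted vertically by a common height `T` well above the graph, where
a straight segment joins them. -/
lemma HasLipschitzBoundary.exists_joinedIn {N : ℕ} {Ω : Set (Eucl N)}
    (hL : HasLipschitzBoundary Ω) {x : Eucl N} (hx : x ∈ frontier Ω) :
    ∃ δ > 0, ∀ y ∈ Ω ∩ Metric.ball x δ, ∀ y' ∈ Ω ∩ Metric.ball x δ, JoinedIn Ω y y' := by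
  obtain ⟨e, γ, K, r, he, hγ, hr, hΩ⟩ := hL x hx
  set P : Eucl N → Eucl N := fun z => z - inner ℝ e z • e with hP
  have hPc : Continuous P := by fun_prop
  have hee : inner ℝ e e = 1 := by rw [real_inner_self_eq_norm_sq, he]; norm_num
  have hPt : ∀ z (t : ℝ), P (z + t • e) = P z := by
    intro z t
    simp only [hP, inner_add_right, inner_smul_right, hee, mul_one, add_smul]
    abel
  have hin : ∀ z (t : ℝ), inner ℝ e (z + t • e) = inner ℝ e z + t := by
    intro z t
    rw [inner_add_right, inner_smul_right, hee, mul_one]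
  have habs : ∀ z : Eucl N, |inner ℝ e z| ≤ ‖z‖ := fun z => by
    simpa [he] using abs_real_inner_le_norm e z
  have hPd : ∀ z z', dist (P z) (P z') ≤ 2 * dist z z' := by
    intro z z'
    have h1 : P z - P z' = (z - z') - inner ℝ e (z - z') • e := by
      simp only [hP, inner_sub_right, sub_smul]; abel
    rw [dist_eq_norm, dist_eq_norm, h1]
    refine (norm_sub_le _ _).trans ?_
    rw [norm_smul, he, mul_one, Real.norm_eq_abs]
    linarith [habs (z - z')]
  -- Strictly below the graph there is a whole neighbourhood free of `Ω`, impossible at a boundary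
  -- point.
  have hγx : γ (P x) ≤ inner ℝ e x := by
    by_contra hlt
    push Not at hlt
    have hopen : ∀ᶠ z in 𝓝 x, inner ℝ e z < γ (P z) :=
      (by fun_prop : Continuous fun z : Eucl N => inner ℝ e z).continuousAt.eventually_lt
        (hγ.continuous.comp hPc).continuousAt hlt
    obtain ⟨z, ⟨hz1, hz2⟩, hz3⟩ := mem_closure_iff_nhds.1 hx.1 _
      (inter_mem hopen (Metric.ball_mem_nhds x hr))
    exact absurd ((hΩ z hz2).1 hz3) (not_lt.2 (le_of_lt hz1))
  have hK : (0 : ℝ) ≤ K := K.2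
  -- `P` is `2`-Lipschitz, so over the `δ`-ball `γ ∘ P` rises by at most `2Kδ` above its value at
  -- `x`, and the height falls by at most `δ`. The lift `T = (2K + 2)δ` beats both strictly, and `T
  -- + δ < r` keeps lifted points inside the chart.
  set δ : ℝ := r / (2 * K + 4) with hδ
  have hδ0 : 0 < δ := by positivity
  have hδr : (2 * K + 4) * δ = r := by rw [hδ]; field_simp
  set T : ℝ := (2 * K + 2) * δ with hT
  have hT0 : 0 < T := by positivity
  have hball : ∀ m ∈ Metric.ball x δ, ∀ t ∈ Icc 0 T, m + t • e ∈ Metric.ball x r := by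
    intro m hm t ht
    rw [Metric.mem_ball, dist_eq_norm] at hm ⊢
    have h1 : m + t • e - x = (m - x) + t • e := by abel
    rw [h1]
    refine (norm_add_le _ _).trans_lt ?_
    rw [norm_smul, he, mul_one, Real.norm_of_nonneg ht.1]
    nlinarith [ht.2]
  have hup : ∀ m ∈ Metric.ball x δ, m + T • e ∈ Ω := by
    intro m hm
    rw [hΩ _ (hball m hm T ⟨hT0.le, le_rfl⟩)]
    show γ (P (m + T • e)) < _
    rw [hPt, hin]
    have hm' : dist m x < δ := hm
    have h1 : γ (P m) ≤ γ (P x) + K * (2 * δ) := by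
      have h2 := hγ.dist_le_mul (P m) (P x)
      have h3 : dist (P m) (P x) ≤ 2 * δ := (hPd m x).trans (by linarith)
      have h4 := (le_abs_self _).trans ((Real.dist_eq _ _).symm.le.trans h2)
      nlinarith [mul_le_mul_of_nonneg_left h3 hK]
    have h5 : inner ℝ e x ≤ inner ℝ e m + δ := by
      have h6 := habs (x - m)
      rw [inner_sub_right, ← dist_eq_norm, dist_comm] at h6
      linarith [le_abs_self (inner ℝ e x - inner ℝ e m)]
    have : T = K * (2 * δ) + 2 * δ := by rw [hT]; ring
    linarith
  have hvert : ∀ y ∈ Ω ∩ Metric.ball x δ, JoinedIn Ω y (y + T • e) := by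
    intro y hy
    refine JoinedIn.of_segment_subset ?_
    rw [segment_eq_image']
    rintro _ ⟨θ, hθ, rfl⟩
    have h1 : y + θ • (y + T • e - y) = y + (θ * T) • e := by
      rw [add_sub_cancel_left, smul_smul]
    simp only [h1]
    have hθT : θ * T ∈ Icc 0 T := ⟨mul_nonneg hθ.1 hT0.le, mul_le_of_le_one_left hT0.le hθ.2⟩
    rw [hΩ _ (hball y hy.2 _ hθT)]
    show γ (P (y + (θ * T) • e)) < _
    rw [hPt, hin]
    have h2 : γ (P y) < inner ℝ e y :=
      (hΩ y (by simpa using hball y hy.2 0 ⟨le_rfl, hT0.le⟩)).1 hy.1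
    linarith [hθT.1]
  refine ⟨δ, hδ0, fun y hy y' hy' => (hvert y hy).trans (JoinedIn.trans ?_ (hvert y' hy').symm)⟩
  refine JoinedIn.of_segment_subset ?_
  rw [segment_eq_image']
  rintro _ ⟨θ, hθ, rfl⟩
  have h1 : y + T • e + θ • (y' + T • e - (y + T • e)) = (y + θ • (y' - y)) + T • e := by
    rw [add_sub_add_right_eq_sub]; abel
  simp only [h1]
  refine hup _ ?_
  exact (convex_ball x δ).add_smul_sub_mem hy.2 hy'.2 hθ

/-- Near a boundary point all of `Ω` is path-joined within `Ω`, and some of those points belong to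
the component. -/
lemma HasLipschitzBoundary.exists_ball_inter_subset {N : ℕ} {Ω : Set (Eucl N)}
    (hΩ : IsOpen Ω) (hL : HasLipschitzBoundary Ω) {x₀ x : Eucl N}
    (hx : x ∈ frontier (connectedComponentIn Ω x₀)) :
    ∃ δ > 0, Ω ∩ Metric.ball x δ ⊆ connectedComponentIn Ω x₀ := by
  obtain ⟨δ, hδ, hj⟩ := hL.exists_joinedIn (frontier_connectedComponentIn_subset hΩ x₀ hx)
  obtain ⟨y, hy1, hy2⟩ := mem_closure_iff_nhds.1 hx.1 _ (Metric.ball_mem_nhds x hδ)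
  refine ⟨δ, hδ, fun z hz => ?_⟩
  have h1 := hj y ⟨connectedComponentIn_subset Ω x₀ hy2, hy1⟩ z hz
  rw [connectedComponentIn_eq hy2]
  have hyΩ := connectedComponentIn_subset Ω x₀ hy2
  exact (isPathConnected_pathComponentIn hyΩ).isConnected.isPreconnected.subset_connectedComponentIn
    (mem_pathComponentIn_self hyΩ) pathComponentIn_subset h1

/-! ### Pointwise estimates -/

lemma mul_le_rpow_add_rpow {p : ℝ} (hp : 1 < p) {x y : ℝ} (hx : 0 ≤ x) (hy : 0 ≤ y) :
    x * y ≤ x ^ (p / (p - 1)) + y ^ p := by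
  have hc : p.HolderConjugate (p / (p - 1)) := Real.HolderConjugate.conjExponent hp
  have h1 := Real.young_inequality_of_nonneg hx hy hc.symm
  have h2 : x ^ (p / (p - 1)) / (p / (p - 1)) ≤ x ^ (p / (p - 1)) :=
    div_le_self (Real.rpow_nonneg hx _) hc.symm.lt.le
  have h3 : y ^ p / p ≤ y ^ p := div_le_self (Real.rpow_nonneg hy _) hp.le
  linarith

/-- The conjugate exponent turns `ξ ^ (p - 1)` into `ξ ^ p`; the sum is bounded by twice the maximum
to avoid a power of a sum. -/
lemma rpow_growth_le {p : ℝ} (hp : 1 < p) {A z ξ β : ℝ} (hA : 0 ≤ A) (hβ : 0 < β) (hξ : 0 ≤ ξ)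
    (h : A ≤ β * (z + ξ ^ (p - 1))) :
    A ^ (p / (p - 1)) ≤ (2 * β) ^ (p / (p - 1)) * (|z| ^ (p / (p - 1)) + ξ ^ p) := by
  set q := p / (p - 1) with hq
  have hq0 : 0 ≤ q := div_nonneg (by linarith) (by linarith)
  have hy : 0 ≤ ξ ^ (p - 1) := Real.rpow_nonneg hξ _
  have hyq : (ξ ^ (p - 1)) ^ q = ξ ^ p := by
    rw [← Real.rpow_mul hξ, hq, mul_div_cancel₀ _ (by linarith)]
  set M := max |z| (ξ ^ (p - 1)) with hM
  have hM0 : 0 ≤ M := le_max_of_le_right hy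
  have h1 : A ≤ 2 * β * M := by
    have := le_abs_self z
    have := le_max_left |z| (ξ ^ (p - 1))
    have := le_max_right |z| (ξ ^ (p - 1))
    nlinarith
  have h2 : M ^ q ≤ |z| ^ q + ξ ^ p := by
    have := Real.rpow_nonneg (abs_nonneg z) q
    have := Real.rpow_nonneg hξ p
    rcases max_choice |z| (ξ ^ (p - 1)) with h | h <;> rw [hM, h]
    · linarith
    · rw [hyq]; linarith
  calc A ^ q ≤ (2 * β * M) ^ q := Real.rpow_le_rpow hA h1 hq0
    _ = (2 * β) ^ q * M ^ q := Real.mul_rpow (by positivity) hM0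
    _ ≤ _ := by gcongr

/-! ### Gradients of crossed truncations -/

/-- The value of the gradient of `T_1(u - T_r(v))` at a point at which `u`, `v` and their gradients
have the values `s`, `t` and `ξ`, `η`. -/
noncomputable def crossGrad {N : ℕ} (r s t : ℝ) (ξ η : Eucl N) : Eucl N :=
  if |trunc (r + 1) s - trunc r t| < 1 then
    (if |s| ≤ r + 1 then ξ else 0) - (if |t| ≤ r then η else 0) else 0

section crossGrad
variable {N : ℕ} {r s t : ℝ} {ξ η : Eucl N}

lemma crossGrad_of_le (hs : 0 ≤ s) (ht : 0 ≤ t) (hsr : s ≤ r) (htr : t ≤ r) :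
    crossGrad r s t ξ η = if |s - t| < 1 then ξ - η else 0 := by
  have h1 : |s| ≤ r + 1 := by rw [abs_of_nonneg hs]; linarith
  have h2 : |t| ≤ r := by rwa [abs_of_nonneg ht]
  rw [crossGrad, trunc_of_abs_le h1, trunc_of_abs_le h2, if_pos h1, if_pos h2]

lemma crossGrad_of_lt_of_le (ht : 0 ≤ t) (hsr : r < s) (htr : t ≤ r) :
    crossGrad r s t ξ η = if s - t < 1 then ξ - η else 0 := by
  have h2 : |t| ≤ r := by rwa [abs_of_nonneg ht]
  rw [crossGrad, trunc_of_abs_le h2, if_pos h2]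
  rcases le_or_gt s (r + 1) with h | h
  · have h1 : |s| ≤ r + 1 := by rwa [abs_of_nonneg (by linarith)]
    rw [trunc_of_abs_le h1, if_pos h1, abs_of_nonneg (by linarith)]
  · rw [trunc_of_le (by linarith) h.le, abs_of_nonneg (by linarith), if_neg (by linarith),
      if_neg (by linarith)]

lemma crossGrad_of_lt (hr : 0 ≤ r) (hs : 0 ≤ s) (htr : r < t) :
    crossGrad r s t ξ η = if r - 1 < s ∧ s < r + 1 then ξ else 0 := by
  have h2 : ¬ |t| ≤ r := by rw [abs_of_nonneg (by linarith)]; linarith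
  rw [crossGrad, trunc_of_le hr htr.le, if_neg h2, sub_zero]
  rcases le_or_gt s (r + 1) with h | h
  · have h1 : |s| ≤ r + 1 := by rwa [abs_of_nonneg hs]
    have h5 : |s - r| < 1 ↔ r - 1 < s ∧ s < r + 1 := by
      rw [abs_lt]
      constructor <;> rintro ⟨h3, h4⟩ <;> constructor <;> linarith
    rw [trunc_of_abs_le h1, if_pos h1]
    simp only [h5]
  · rw [trunc_of_le (by linarith) h.le, if_neg (by rw [abs_of_nonneg] <;> linarith),
      if_neg (fun h3 => by linarith [h3.2])]

lemma crossGrad_eq_zero (hs : r + 1 < |s|) (hs0 : 0 ≤ s) (hr : 0 ≤ r) :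
    crossGrad r s t ξ η = 0 := by
  rw [abs_of_nonneg hs0] at hs
  rw [crossGrad, trunc_of_le (by linarith) hs.le, if_neg]
  have := (abs_le.1 (abs_trunc_le hr t)).2
  rw [abs_of_nonneg (by linarith)]
  linarith

lemma inner_crossGrad_nonneg {A : Eucl N} (hr : 0 ≤ r) (hs : 0 ≤ s) (htr : r < t)
    (hA : 0 ≤ inner ℝ A ξ) : 0 ≤ inner ℝ A (crossGrad r s t ξ η) := by
  rw [crossGrad_of_lt hr hs htr]
  split_ifs
  · exact hA
  · simp

/-- The `ξ` part has a sign by coercivity. The `η` part survives only if `s - t < 1`, which puts `s`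
in the band above `r` and `t` in the band below. -/
lemma le_inner_crossGrad {A : Eucl N} (ht : 0 ≤ t) (hsr : r < s) (htr : t ≤ r)
    (hA : 0 ≤ inner ℝ A ξ) : - (if (r < s ∧ s ≤ r + 1) ∧ (r - 1 < t ∧ t ≤ r) then ‖A‖ * ‖η‖ else 0)
      ≤ inner ℝ A (crossGrad r s t ξ η) := by
  rw [crossGrad_of_lt_of_le ht hsr htr]
  by_cases h : s - t < 1
  · rw [if_pos h, if_pos ⟨⟨hsr, by linarith⟩, by linarith, htr⟩, inner_sub_right]
    linarith [real_inner_le_norm A η]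
  · rw [if_neg h, inner_zero_right, neg_nonpos]
    split_ifs <;> positivity

/-- The lower bound behind the uniqueness of entropy solutions. -/
lemma le_inner_crossGrad_add {A B : Eucl N} (hr : 0 ≤ r) (hs : 0 ≤ s) (ht : 0 ≤ t)
    (hA : 0 ≤ inner ℝ A ξ) (hB : 0 ≤ inner ℝ B η) :
    (if s ≤ r ∧ t ≤ r ∧ |s - t| < 1 then inner ℝ (A - B) (ξ - η) else 0)
      ≤ inner ℝ A (crossGrad r s t ξ η) + inner ℝ B (crossGrad r t s η ξ)
        + (if (r < s ∧ s ≤ r + 1) ∧ (r - 1 < t ∧ t ≤ r) then ‖A‖ * ‖η‖ else 0)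
        + (if (r < t ∧ t ≤ r + 1) ∧ (r - 1 < s ∧ s ≤ r) then ‖B‖ * ‖ξ‖ else 0) := by
  have hn1 : 0 ≤ (if (r < s ∧ s ≤ r + 1) ∧ (r - 1 < t ∧ t ≤ r) then ‖A‖ * ‖η‖ else 0) := by
    split_ifs <;> positivity
  have hn2 : 0 ≤ (if (r < t ∧ t ≤ r + 1) ∧ (r - 1 < s ∧ s ≤ r) then ‖B‖ * ‖ξ‖ else 0) := by
    split_ifs <;> positivity
  -- Both below `r`: the monotonicity expression. One above: a nonnegative term plus one with a band
  -- error. Both above: two nonnegative terms.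
  rcases le_or_gt s r with hsr | hsr <;> rcases le_or_gt t r with htr | htr
  · rw [crossGrad_of_le hs ht hsr htr, crossGrad_of_le ht hs htr hsr, abs_sub_comm t s]
    by_cases h : |s - t| < 1
    · rw [if_pos ⟨hsr, htr, h⟩, if_pos h, if_pos h]
      have : inner ℝ (A - B) (ξ - η) = inner ℝ A (ξ - η) + inner ℝ B (η - ξ) := by
        rw [← neg_sub ξ η, inner_neg_right, inner_sub_left]; ring
      linarith
    · rw [if_neg (fun h' => h h'.2.2), if_neg h, if_neg h, inner_zero_right, inner_zero_right]
      linarith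
  · rw [if_neg (fun h => by linarith [h.2.1])]
    have h1 := inner_crossGrad_nonneg (η := η) hr hs htr hA
    have h2 := le_inner_crossGrad (η := ξ) hs htr hsr hB
    linarith
  · rw [if_neg (fun h => by linarith [h.1])]
    have h1 := inner_crossGrad_nonneg (η := ξ) hr ht hsr hB
    have h2 := le_inner_crossGrad (η := η) ht hsr htr hA
    linarith
  · rw [if_neg (fun h => by linarith [h.1])]
    have h1 := inner_crossGrad_nonneg (η := η) hr hs htr hA
    have h2 := inner_crossGrad_nonneg (η := ξ) hr ht hsr hB
    linarith

/-- If `t ≤ r`, only `ξ - η` on `|s - t| < 1` could appear, and `h` removes it. If `t > r`, the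
truncation of `t` is frozen at `r` and only `ξ` on `r - 1 < s < r + 1` is left. -/
lemma norm_crossGrad_le (hr : 0 ≤ r) (hs : 0 ≤ s) (ht : 0 ≤ t) (h : |s - t| < 1 → ξ = η) :
    ‖crossGrad r s t ξ η‖ ≤ (if r < s ∧ s ≤ r + 1 then ‖ξ‖ else 0)
      + (if r - 1 < s ∧ s ≤ r then ‖ξ‖ else 0) + (if r - 1 < t ∧ t ≤ r then ‖η‖ else 0) := by
  have hn1 : 0 ≤ (if r < s ∧ s ≤ r + 1 then ‖ξ‖ else 0) := by split_ifs <;> positivity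
  have hn2 : 0 ≤ (if r - 1 < s ∧ s ≤ r then ‖ξ‖ else 0) := by split_ifs <;> positivity
  have hn3 : 0 ≤ (if r - 1 < t ∧ t ≤ r then ‖η‖ else 0) := by split_ifs <;> positivity
  rcases le_or_gt t r with htr | htr
  · have h0 : crossGrad r s t ξ η = 0 := by
      rcases le_or_gt s r with hsr | hsr
      · rw [crossGrad_of_le hs ht hsr htr]
        exact ite_eq_right_iff.2 fun h1 => sub_eq_zero.2 (h h1)
      · rw [crossGrad_of_lt_of_le ht hsr htr]
        exact ite_eq_right_iff.2 fun h1 =>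
          sub_eq_zero.2 (h (by rwa [abs_of_nonneg (by linarith)]))
    rw [h0, norm_zero]
    linarith
  · rw [crossGrad_of_lt hr hs htr]
    by_cases h1 : r - 1 < s ∧ s < r + 1
    · have h3 : ‖ξ‖ ≤ (if r < s ∧ s ≤ r + 1 then ‖ξ‖ else 0)
          + (if r - 1 < s ∧ s ≤ r then ‖ξ‖ else 0) := by
        rcases le_or_gt s r with hsr | hsr
        · rw [if_pos (show r - 1 < s ∧ s ≤ r from ⟨h1.1, hsr⟩)]; linarith
        · rw [if_pos (show r < s ∧ s ≤ r + 1 from ⟨hsr, h1.2.le⟩)]; linarith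
      rw [if_pos h1]
      linarith
    · rw [if_neg h1, norm_zero]; linarith

end crossGrad

lemma trunc_sub_trunc_eq {r s t : ℝ} (hr : 0 ≤ r) (hs : 0 ≤ s) :
    trunc 1 (trunc (r + 1) s - trunc r t) = trunc 1 (s - trunc r t) := by
  rcases le_or_gt s (r + 1) with h | h
  · rw [trunc_of_abs_le (k := r + 1) (by rwa [abs_of_nonneg hs])]
  · have := (abs_le.1 (abs_trunc_le hr t)).2
    rw [trunc_of_le (k := r + 1) (by linarith) h.le, trunc_of_le zero_le_one (by linarith),
      trunc_of_le zero_le_one (by linarith)]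

lemma trunc_add_one_sub_trunc {r s : ℝ} (hr : 0 ≤ r) (hs : 0 ≤ s) :
    trunc (r + 1) s - trunc r s = trunc 1 (s - trunc r s) := by
  rw [← trunc_sub_trunc_eq hr hs, eq_comm, trunc_of_abs_le]
  rcases le_or_gt s r with h | h
  · rw [trunc_of_abs_le (k := r + 1), trunc_of_abs_le] <;> rw [abs_of_nonneg] <;> linarith
  · rw [trunc_of_le hr h.le]
    rcases le_or_gt s (r + 1) with h' | h'
    · rw [trunc_of_abs_le, abs_of_nonneg] <;> (try rw [abs_of_nonneg]) <;> linarith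
    · rw [trunc_of_le (by linarith) h'.le, abs_of_nonneg] <;> linarith

/-! ### Entropy solutions -/

/-- `u` is an entropy solution with generalized gradient `G`, boundary trace `w` and boundary
datum `H = h(w) g`, in the form in which the test functions are truncations. -/
structure IsEntropyTriple {N : ℕ} (Ω : Set (Eucl N)) (p : ℝ) (a : Eucl N → Eucl N → Eucl N)
    (f lam : Eucl N → ℝ) (σ : ℝ → ℝ) (H : Eucl N → ℝ)
    (u : Eucl N → ℝ) (G : Eucl N → Eucl N) (w : Eucl N → ℝ) : Prop where
  aemeasurable : AEMeasurable u (volOn Ω)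
  nonneg : ∀ᵐ x ∂volOn Ω, 0 ≤ u x
  truncGradient : HasTruncGradient Ω p u G
  truncTrace : IsTruncTrace Ω u w
  memLp_flux : ∀ k : ℝ, 0 < k → MemLp (fun x => a x ({y | |u y| ≤ k}.indicator G x))
    (ENNReal.ofReal (p / (p - 1))) (volOn Ω)
  integrable_lam : Integrable (fun x => lam x * σ (w x)) (surfOn (frontier Ω))
  integrable_H : Integrable H (surfOn (frontier Ω))
  identity : ∀ v τ : Eucl N → ℝ, MemSobolev Ω p v → MemLp v ∞ (volOn Ω) → IsTrace Ω v τ →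
    ∀ D : Eucl N → Eucl N, HasSobolevGradient Ω p (fun x => trunc 1 (u x - v x)) D →
        ∫ x, inner ℝ (a x (G x)) (D x) ∂volOn Ω
            + ∫ x, lam x * σ (w x) * trunc 1 (w x - τ x) ∂surfOn (frontier Ω)
          = ∫ x, f x * trunc 1 (u x - v x) ∂volOn Ω
            + ∫ x, H x * trunc 1 (w x - τ x) ∂surfOn (frontier Ω)

/-- The definition supplies some gradient of `T_1(u - v)`; uniqueness of weak gradients allows any
other, in particular the explicit `crossGrad`. -/
lemma IsEntropySolution.exists_triple {N : ℕ} {Ω : Set (Eucl N)} (hΩ : IsOpen Ω)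
    (hΩb : Bornology.IsBounded Ω) {p : ℝ} (hp : 1 < p) {a : Eucl N → Eucl N → Eucl N}
    {f lam g : Eucl N → ℝ} {σ : ℝ → ℝ} {h : ℝ → EReal} {u : Eucl N → ℝ}
    (hu : IsEntropySolution Ω p a f lam g σ h u) :
    ∃ G w, IsEntropyTriple Ω p a f lam σ (fun x => (h (w x) * (g x : EReal)).toReal) u G w ∧
      ∀ᵐ x ∂surfOn (frontier Ω), h (w x) * (g x : EReal) ≠ ⊤ ∧ h (w x) * (g x : EReal) ≠ ⊥ := by
  obtain ⟨h1, h2, G, w, h3, h4, h5, h6, h7, h8, h9⟩ := hu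
  refine ⟨G, w, ⟨h1, h2, h3, h4, h5, h6, h8, fun v τ hv hv' hτ D hD => ?_⟩, h7⟩
  obtain ⟨D', hD', hid⟩ := h9 v τ hv hv' hτ 1 one_pos
  rw [← hid]
  congr 1
  exact integral_congr_ae ((hD.ae_eq hΩ hΩb hp hD').mono fun x hx => by simp only [hx])

lemma tendsto_integral_mul_trunc {α : Type*} [MeasurableSpace α] {μ : Measure α} {F b c : α → ℝ}
    (hF : Integrable F μ) (hb : AEMeasurable b μ) (hc : AEMeasurable c μ) :
    Tendsto (fun n : ℕ => ∫ x, F x * trunc 1 (b x - trunc (n + 1) (c x)) ∂μ) atTop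
      (𝓝 (∫ x, F x * trunc 1 (b x - c x) ∂μ)) := by
  refine tendsto_integral_of_dominated_convergence (fun x => |F x|) (fun n => ?_) hF.abs
    (fun n => Eventually.of_forall fun x => ?_) (Eventually.of_forall fun x => ?_)
  · exact hF.aestronglyMeasurable.mul ((continuous_trunc 1).measurable.comp_aemeasurable
      (hb.sub ((continuous_trunc _).measurable.comp_aemeasurable hc))).aestronglyMeasurable
  · rw [Real.norm_eq_abs, abs_mul]
    exact mul_le_of_le_one_right (abs_nonneg _) (abs_trunc_le zero_le_one _)
  · have h1 : Tendsto (fun n : ℕ => trunc ((n : ℝ) + 1) (c x)) atTop (𝓝 (c x)) := by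
      have := (tendsto_trunc_nat (c x)).comp (tendsto_add_atTop_nat 1)
      simpa [Function.comp_def] using this
    exact (((continuous_trunc 1).tendsto _).comp (h1.const_sub (b x))).const_mul _

/-! ### Fluxes and decay of the energy -/

section Triple

variable {N : ℕ} {Ω : Set (Eucl N)} {p : ℝ} {a : Eucl N → Eucl N → Eucl N}
  {f lam : Eucl N → ℝ} {σ : ℝ → ℝ} {H H' : Eucl N → ℝ} {u u' : Eucl N → ℝ}
  {G G' : Eucl N → Eucl N} {w w' : Eucl N → ℝ}

/-- The fluxes converge, for all choices of the gradients of `T_1(u - T_{n+1}(u'))`. -/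
lemma IsEntropyTriple.tendsto_flux (hΩ : IsOpen Ω) (hΩb : Bornology.IsBounded Ω)
    (hf : Integrable f (volOn Ω))
    (hu : IsEntropyTriple Ω p a f lam σ H u G w) (hu' : IsEntropyTriple Ω p a f lam σ H' u' G' w')
    {D : ℕ → Eucl N → Eucl N}
    (hD : ∀ n : ℕ, HasSobolevGradient Ω p (fun x => trunc 1 (u x - trunc (n + 1) (u' x))) (D n)) :
    Tendsto (fun n => ∫ x, inner ℝ (a x (G x)) (D n x) ∂volOn Ω) atTop
      (𝓝 (∫ x, f x * trunc 1 (u x - u' x) ∂volOn Ω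
        + ∫ x, H x * trunc 1 (w x - w' x) ∂surfOn (frontier Ω)
        - ∫ x, lam x * σ (w x) * trunc 1 (w x - w' x) ∂surfOn (frontier Ω))) := by
  have hw := hu.truncTrace.aemeasurable hΩ hΩb hu.aemeasurable
  have hw' := hu'.truncTrace.aemeasurable hΩ hΩb hu'.aemeasurable
  -- Each flux is given by the entropy identity in terms of integrals against `f`, `H` and `λσ(w)`,
  -- which converge by dominated convergence; no limit is taken in the gradients.
  refine (((tendsto_integral_mul_trunc hf hu.aemeasurable hu'.aemeasurable).add
    (tendsto_integral_mul_trunc hu.integrable_H hw hw')).sub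
    (tendsto_integral_mul_trunc hu.integrable_lam hw hw')).congr fun n => ?_
  have hn : (0 : ℝ) < n + 1 := by positivity
  have hb : MemLp (fun x => trunc ((n : ℝ) + 1) (u' x)) ∞ (volOn Ω) :=
    memLp_top_of_bound ((continuous_trunc _).measurable.comp_aemeasurable
      hu'.aemeasurable).aestronglyMeasurable (n + 1)
      (Eventually.of_forall fun x => abs_trunc_le hn.le _)
  have := hu.identity _ _ ⟨_, hu'.truncGradient.2 _ hn⟩ hb (hu'.truncTrace _ hn) _ (hD n)
  linarith

/-- `u` itself need not be a Sobolev function, but since `u ≥ 0`, `T_1(u - T_r(u'))` does not change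
when `u` is replaced by `T_{r+1}(u)`. -/
lemma IsEntropyTriple.hasSobolevGradient_cross (hΩ : IsOpen Ω) (hΩb : Bornology.IsBounded Ω)
    (hp : 1 < p)
    (hu : IsEntropyTriple Ω p a f lam σ H u G w) (hu' : IsEntropyTriple Ω p a f lam σ H' u' G' w')
    {r : ℝ} (hr : 0 < r) :
    HasSobolevGradient Ω p (fun x => trunc 1 (u x - trunc r (u' x)))
      (fun x => crossGrad r (u x) (u' x) (G x) (G' x)) := by
  have h1 := ((hu.truncGradient.2 (r + 1) (by linarith)).sub hΩb hp
    (hu'.truncGradient.2 r hr)).trunc hΩ hΩb hp one_pos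
  refine h1.congr ?_ (Eventually.of_forall fun x => ?_)
  · filter_upwards [hu.nonneg] with x hx using trunc_sub_trunc_eq hr.le hx
  · simp only [crossGrad, indicator, mem_ofPred_eq]

/-- The part of the domain in which `u` is in `(r, r + 1]`. -/
def bandSet (u : Eucl N → ℝ) (r : ℝ) : Set (Eucl N) := {x | r < u x ∧ u x ≤ r + 1}

lemma nullMeasurableSet_bandSet (hu : AEMeasurable u (volOn Ω)) (r : ℝ) :
    NullMeasurableSet (bandSet u r) (volOn Ω) :=
  (nullMeasurableSet_lt aemeasurable_const hu).inter (nullMeasurableSet_le hu aemeasurable_const)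

/-- For `u ≥ 0` the function is just `T_{r+1}(u) - T_r(u)`, so its gradient is a difference of two
known ones. -/
lemma IsEntropyTriple.hasSobolevGradient_band (hΩb : Bornology.IsBounded Ω) (hp : 1 < p)
    (hu : IsEntropyTriple Ω p a f lam σ H u G w) {r : ℝ} (hr : 0 < r) :
    HasSobolevGradient Ω p (fun x => trunc 1 (u x - trunc r (u x)))
      ((bandSet u r).indicator G) := by
  refine ((hu.truncGradient.2 (r + 1) (by linarith)).sub hΩb hp
    (hu.truncGradient.2 r hr)).congr ?_ ?_
  · filter_upwards [hu.nonneg] with x hx using trunc_add_one_sub_trunc hr.le hx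
  · filter_upwards [hu.nonneg] with x hx
    have habs := abs_of_nonneg hx
    rcases le_or_gt (u x) r with h1 | h1
    · rw [indicator_of_mem (show x ∈ {x | |u x| ≤ r + 1} from habs.trans_le (by linarith)),
        indicator_of_mem (show x ∈ {x | |u x| ≤ r} from habs.trans_le h1),
        indicator_of_notMem (fun h => not_lt.2 h1 h.1), sub_self]
    · rw [indicator_of_notMem (s := {x | |u x| ≤ r})
        (fun h => not_le.2 h1 (habs.symm.trans_le h)), sub_zero]
      rcases le_or_gt (u x) (r + 1) with h2 | h2
      · rw [indicator_of_mem (show x ∈ {x | |u x| ≤ r + 1} from habs.trans_le h2),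
          indicator_of_mem (show x ∈ bandSet u r from ⟨h1, h2⟩)]
      · rw [indicator_of_notMem (s := {x | |u x| ≤ r + 1})
          (fun h => not_le.2 h2 (habs.symm.trans_le h)),
          indicator_of_notMem (fun h => not_le.2 h2 h.2)]

lemma IsEntropyTriple.aemeasurable_flux (hu : IsEntropyTriple Ω p a f lam σ H u G w) :
    AEMeasurable (fun x => a x (G x)) (volOn Ω) := by
  refine aemeasurable_of_tendsto_metrizable_ae' (fun n : ℕ =>
    (hu.memLp_flux (n + 1) (by positivity)).aestronglyMeasurable.aemeasurable)
    (Eventually.of_forall fun x => ?_)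
  refine tendsto_const_nhds.congr' ?_
  obtain ⟨m, hm⟩ := exists_nat_ge |u x|
  filter_upwards [eventually_ge_atTop m] with n hn
  have h1 : |u x| ≤ n + 1 := by
    have : (m : ℝ) ≤ n := by exact_mod_cast hn
    linarith
  rw [indicator_of_mem (show x ∈ {y | |u y| ≤ (n : ℝ) + 1} from h1)]

lemma integrable_norm_rpow {E : Type*} [NormedAddCommGroup E] {p : ℝ} (hp : 0 < p)
    {F : Eucl N → E} (hF : MemLp F (ENNReal.ofReal p) (volOn Ω)) :
    Integrable (fun x => ‖F x‖ ^ p) (volOn Ω) := by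
  have := hF.integrable_norm_rpow (by simpa using hp) ENNReal.ofReal_ne_top
  rwa [ENNReal.toReal_ofReal hp.le] at this

/-- The flux has the conjugate integrability only on `{|u| ≤ k}`; `D` vanishes elsewhere, and
Young's inequality does the rest. -/
lemma IsEntropyTriple.integrable_flux (hp : 1 < p) (hu : IsEntropyTriple Ω p a f lam σ H u G w)
    {D : Eucl N → Eucl N} (hD : MemLp D (ENNReal.ofReal p) (volOn Ω)) {k : ℝ} (hk : 0 < k)
    (hDk : ∀ᵐ x ∂volOn Ω, k < |u x| → D x = 0) :
    Integrable (fun x => inner ℝ (a x (G x)) (D x)) (volOn Ω) := by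
  have h1 := integrable_norm_rpow (div_pos (by linarith) (by linarith)) (hu.memLp_flux k hk)
  have h2 := integrable_norm_rpow (by linarith) hD
  refine (h1.add h2).mono' (hu.aemeasurable_flux.aestronglyMeasurable.inner
    hD.aestronglyMeasurable) ?_
  filter_upwards [hDk] with x hx
  simp only [Pi.add_apply]
  by_cases h : |u x| ≤ k
  · rw [indicator_of_mem (show x ∈ {y | |u y| ≤ k} from h)]
    exact (norm_inner_le_norm _ _).trans
      (mul_le_rpow_add_rpow hp (norm_nonneg _) (norm_nonneg _))
  · rw [hx (not_le.1 h), inner_zero_right, norm_zero]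
    positivity

lemma tendsto_integral_indicator_bandSet {Z : Eucl N → ℝ} (hZ : Integrable Z (volOn Ω))
    (hu : AEMeasurable u (volOn Ω)) :
    Tendsto (fun n : ℕ => ∫ x, (bandSet u n).indicator Z x ∂volOn Ω) atTop (𝓝 0) := by
  suffices h : Tendsto (fun n : ℕ => ∫ x, (bandSet u n).indicator Z x ∂volOn Ω) atTop
      (𝓝 (∫ _, (0 : ℝ) ∂volOn Ω)) by simpa only [integral_zero] using h
  refine tendsto_integral_of_dominated_convergence (fun x => ‖Z x‖)
    (fun n => hZ.aestronglyMeasurable.indicator₀ (nullMeasurableSet_bandSet hu n)) hZ.norm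
    (fun n => Eventually.of_forall fun x => norm_indicator_le_norm_self Z x)
    (Eventually.of_forall fun x => tendsto_const_nhds.congr' ?_)
  obtain ⟨m, hm⟩ := exists_nat_ge (u x)
  filter_upwards [eventually_ge_atTop m] with n hn
  have : (m : ℝ) ≤ n := by exact_mod_cast hn
  exact (indicator_of_notMem (fun h => by linarith [h.1]) _).symm

lemma indicator_norm_rpow (hp : 0 < p) (s : Set (Eucl N)) (x : Eucl N) :
    s.indicator (fun x => ‖G x‖ ^ p) x = ‖s.indicator G x‖ ^ p := by
  by_cases h : x ∈ s
  · simp [h]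
  · simp [h, Real.zero_rpow hp.ne']

lemma IsEntropyTriple.integrable_band_rpow (hΩb : Bornology.IsBounded Ω) (hp : 1 < p)
    (hu : IsEntropyTriple Ω p a f lam σ H u G w) {r : ℝ} (hr : 0 < r) :
    Integrable ((bandSet u r).indicator (fun x => ‖G x‖ ^ p)) (volOn Ω) := by
  have := integrable_norm_rpow (by linarith) (hu.hasSobolevGradient_band hΩb hp hr).memLp_grad
  exact this.congr (Eventually.of_forall fun x => (indicator_norm_rpow (by linarith) _ x).symm)

/-- The energy of an entropy solution in the set `{n < u ≤ n + 1}` tends to zero. -/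
lemma IsEntropyTriple.tendsto_energy (hΩ : IsOpen Ω) (hΩb : Bornology.IsBounded Ω) (hp : 1 < p)
    (ha : IsLerayLions Ω p a) (hf : Integrable f (volOn Ω))
    (hu : IsEntropyTriple Ω p a f lam σ H u G w) :
    Tendsto (fun n : ℕ => ∫ x, (bandSet u n).indicator (fun x => ‖G x‖ ^ p) x ∂volOn Ω) atTop
      (𝓝 0) := by
  -- The shift makes the truncation level positive.
  rw [← tendsto_add_atTop_iff_nat 1]
  obtain ⟨α, hα, hco⟩ := ha.coercive
  -- With `u` as its own competitor every term of the limit contains `T_1(0) = 0`; coercivity bounds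
  -- the energy by the flux.
  have h1 := hu.tendsto_flux hΩ hΩb hf hu
    (D := fun n => (bandSet u ((n : ℝ) + 1)).indicator G)
    (fun n => hu.hasSobolevGradient_band hΩb hp (by positivity))
  simp only [sub_self, trunc_zero zero_le_one, mul_zero, integral_zero, add_zero] at h1
  have h2 := h1.const_mul α⁻¹
  rw [mul_zero] at h2
  refine squeeze_zero (fun n => integral_nonneg fun x =>
    indicator_nonneg (fun x _ => by positivity) x) (fun n => ?_) h2
  have hn : (0 : ℝ) < n + 1 := by positivity
  have hgrad := hu.hasSobolevGradient_band hΩb hp hn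
  rw [← integral_const_mul]
  push_cast
  refine integral_mono_ae (hu.integrable_band_rpow hΩb hp hn)
    ((hu.integrable_flux hp hgrad.memLp_grad (k := n + 2) (by positivity) ?_).const_mul _) ?_
  · filter_upwards [hu.nonneg] with x hx hxk
    rw [abs_of_nonneg hx] at hxk
    exact indicator_of_notMem (fun h => by linarith [h.2]) _
  · filter_upwards [hco] with x hx
    by_cases h : x ∈ bandSet u ((n : ℝ) + 1)
    · simp only [indicator_of_mem h]
      rw [inv_mul_eq_div, le_div_iff₀' hα]
      exact hx _
    · simp only [indicator_of_notMem h, inner_zero_right, mul_zero, le_refl]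

end Triple

/-! ### Comparison of two solutions -/

section Comparison

variable {N : ℕ} {Ω : Set (Eucl N)} {p : ℝ} {a : Eucl N → Eucl N → Eucl N}
  {f lam : Eucl N → ℝ} {σ : ℝ → ℝ} {H H₁ H₂ : Eucl N → ℝ} {u u₁ u₂ : Eucl N → ℝ}
  {G G₁ G₂ : Eucl N → Eucl N} {w w₁ w₂ : Eucl N → ℝ} {Z : Eucl N → ℝ}

lemma IsEntropyTriple.integrable_bandWeight (hΩb : Bornology.IsBounded Ω) (hp : 1 < p)
    (hZ : Integrable Z (volOn Ω))
    (hu : IsEntropyTriple Ω p a f lam σ H u G w) {r : ℝ} (hr : 0 < r) :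
    Integrable ((bandSet u r).indicator (fun x => Z x + ‖G x‖ ^ p)) (volOn Ω) := by
  have h1 : Integrable ((bandSet u r).indicator Z) (volOn Ω) :=
    hZ.mono (hZ.aestronglyMeasurable.indicator₀ (nullMeasurableSet_bandSet hu.aemeasurable r))
      (Eventually.of_forall fun x => norm_indicator_le_norm_self Z x)
  refine (h1.add (hu.integrable_band_rpow hΩb hp hr)).congr (Eventually.of_forall fun x => ?_)
  by_cases h : x ∈ bandSet u r <;> simp [h]

lemma IsEntropyTriple.tendsto_bandWeight (hΩ : IsOpen Ω) (hΩb : Bornology.IsBounded Ω)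
    (hp : 1 < p) (ha : IsLerayLions Ω p a) (hf : Integrable f (volOn Ω))
    (hZ : Integrable Z (volOn Ω)) (hu : IsEntropyTriple Ω p a f lam σ H u G w) :
    Tendsto (fun n : ℕ => ∫ x, (bandSet u n).indicator (fun x => Z x + ‖G x‖ ^ p) x ∂volOn Ω)
      atTop (𝓝 0) := by
  have h1 := (tendsto_integral_indicator_bandSet hZ hu.aemeasurable).add
    (hu.tendsto_energy hΩ hΩb hp ha hf)
  rw [add_zero] at h1
  refine h1.congr' ?_
  filter_upwards [eventually_gt_atTop 0] with n hn
  have hn : (0 : ℝ) < n := by exact_mod_cast hn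
  have h2 : Integrable ((bandSet u n).indicator Z) (volOn Ω) :=
    hZ.mono (hZ.aestronglyMeasurable.indicator₀ (nullMeasurableSet_bandSet hu.aemeasurable n))
      (Eventually.of_forall fun x => norm_indicator_le_norm_self Z x)
  rw [← integral_add h2 (hu.integrable_band_rpow hΩb hp hn)]
  refine integral_congr_ae (Eventually.of_forall fun x => ?_)
  simp only [indicator]
  split_ifs <;> simp

lemma IsEntropyTriple.integrable_cross (hΩ : IsOpen Ω) (hΩb : Bornology.IsBounded Ω)
    (hp : 1 < p) (hu₁ : IsEntropyTriple Ω p a f lam σ H₁ u₁ G₁ w₁)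
    (hu₂ : IsEntropyTriple Ω p a f lam σ H₂ u₂ G₂ w₂) {r : ℝ} (hr : 0 < r) :
    Integrable (fun x => inner ℝ (a x (G₁ x)) (crossGrad r (u₁ x) (u₂ x) (G₁ x) (G₂ x)))
      (volOn Ω) := by
  refine hu₁.integrable_flux hp (hu₁.hasSobolevGradient_cross hΩ hΩb hp hu₂ hr).memLp_grad
    (k := r + 1) (by linarith) ?_
  filter_upwards [hu₁.nonneg] with x hx hk using crossGrad_eq_zero hk hx hr.le

/-- Young's inequality separates the product, so each factor is charged to the band of its own
solution, where the energy decays. -/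
lemma mul_norm_le_bandWeight {A ξ η : Eucl N} {r s t β ζ : ℝ} (hp : 1 < p)
    (hβ : 0 < β) (hA : ‖A‖ ≤ β * (ζ + ‖ξ‖ ^ (p - 1))) :
    (if (r < s ∧ s ≤ r + 1) ∧ (r - 1 < t ∧ t ≤ r) then ‖A‖ * ‖η‖ else 0)
      ≤ (2 * β) ^ (p / (p - 1)) *
          (if r < s ∧ s ≤ r + 1 then |ζ| ^ (p / (p - 1)) + ‖ξ‖ ^ p else 0)
        + (if r - 1 < t ∧ t ≤ r then |ζ| ^ (p / (p - 1)) + ‖η‖ ^ p else 0) := by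
  have h1 := mul_le_rpow_add_rpow hp (norm_nonneg A) (norm_nonneg η)
  have h2 := rpow_growth_le hp (norm_nonneg A) hβ (norm_nonneg ξ) hA
  have h3 : 0 ≤ |ζ| ^ (p / (p - 1)) := Real.rpow_nonneg (abs_nonneg _) _
  by_cases hs : r < s ∧ s ≤ r + 1 <;> by_cases ht : r - 1 < t ∧ t ≤ r
  · rw [if_pos ⟨hs, ht⟩, if_pos hs, if_pos ht]; linarith
  all_goals
    rw [if_neg (by tauto)]
    positivity

lemma integral_flux_add_error {α : Type*} [MeasurableSpace α] {μ : Measure α}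
    {F₁ F₂ F₃ F₄ F₅ F₆ : α → ℝ} {C : ℝ} (h₁ : Integrable F₁ μ) (h₂ : Integrable F₂ μ)
    (h₃ : Integrable F₃ μ) (h₄ : Integrable F₄ μ) (h₅ : Integrable F₅ μ) (h₆ : Integrable F₆ μ) :
    ∫ x, (F₁ x + F₂ x) + ((C * F₃ x + F₄ x) + (C * F₅ x + F₆ x)) ∂μ
      = (∫ x, F₁ x ∂μ + ∫ x, F₂ x ∂μ) + ((C * ∫ x, F₃ x ∂μ + ∫ x, F₄ x ∂μ)
        + (C * ∫ x, F₅ x ∂μ + ∫ x, F₆ x ∂μ)) := by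
  have h₃' := h₃.const_mul C
  have h₅' := h₅.const_mul C
  rw [integral_add (f := fun x => F₁ x + F₂ x)
      (g := fun x => (C * F₃ x + F₄ x) + (C * F₅ x + F₆ x)) (h₁.add h₂)
      ((h₃'.add h₄).add (h₅'.add h₆)), integral_add h₁ h₂,
    integral_add (f := fun x => C * F₃ x + F₄ x) (g := fun x => C * F₅ x + F₆ x) (h₃'.add h₄)
      (h₅'.add h₆), integral_add h₃' h₄, integral_add h₅' h₆, integral_const_mul,
    integral_const_mul]

/-- The comparison of two entropy solutions: their gradients agree where the solutions are close,
and the boundary terms vanish. -/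
lemma IsEntropyTriple.comparison (hΩ : IsOpen Ω) (hΩb : Bornology.IsBounded Ω)
    (hp : 1 < p) (ha : IsLerayLions Ω p a) (hf : Integrable f (volOn Ω))
    (hu₁ : IsEntropyTriple Ω p a f lam σ H₁ u₁ G₁ w₁)
    (hu₂ : IsEntropyTriple Ω p a f lam σ H₂ u₂ G₂ w₂)
    (hσ : ∀ᵐ x ∂surfOn (frontier Ω),
      0 ≤ (lam x * σ (w₁ x) - lam x * σ (w₂ x)) * trunc 1 (w₁ x - w₂ x))
    (hH : ∀ᵐ x ∂surfOn (frontier Ω), (H₁ x - H₂ x) * trunc 1 (w₁ x - w₂ x) ≤ 0) :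
    (∀ᵐ x ∂volOn Ω, |u₁ x - u₂ x| < 1 → G₁ x = G₂ x) ∧
      ∀ᵐ x ∂surfOn (frontier Ω),
        (lam x * σ (w₁ x) - lam x * σ (w₂ x)) * trunc 1 (w₁ x - w₂ x) = 0 := by
  obtain ⟨α, hα, hco⟩ := ha.coercive
  obtain ⟨β, z, hβ, -, hz, hgr⟩ := ha.growth
  set q := p / (p - 1) with hq
  have hq0 : 0 < q := div_pos (by linarith) (by linarith)
  set Z : Eucl N → ℝ := fun x => |z x| ^ q
  have hZ : Integrable Z (volOn Ω) := integrable_norm_rpow hq0 hz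
  set C : ℝ := (2 * β) ^ q with hC
  have hw₁ := hu₁.truncTrace.aemeasurable hΩ hΩb hu₁.aemeasurable
  have hw₂ := hu₂.truncTrace.aemeasurable hΩ hΩb hu₂.aemeasurable
  -- the limit of the fluxes
  have hflux := (hu₁.tendsto_flux hΩ hΩb hf hu₂
      (fun n => hu₁.hasSobolevGradient_cross hΩ hΩb hp hu₂ (r := (n : ℝ) + 1) (by positivity))).add
    (hu₂.tendsto_flux hΩ hΩb hf hu₁
      (fun n => hu₂.hasSobolevGradient_cross hΩ hΩb hp hu₁ (r := (n : ℝ) + 1) (by positivity)))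
  have hTw : ∀ F : Eucl N → ℝ, Integrable F (surfOn (frontier Ω)) →
      Integrable (fun x => F x * trunc 1 (w₁ x - w₂ x)) (surfOn (frontier Ω)) := fun F hF =>
    hF.mul_bdd (c := 1) ((continuous_trunc 1).measurable.comp_aemeasurable
      (hw₁.sub hw₂)).aestronglyMeasurable (Eventually.of_forall fun x => abs_trunc_le zero_le_one _)
  have hlim : (∫ x, f x * trunc 1 (u₁ x - u₂ x) ∂volOn Ω
        + ∫ x, H₁ x * trunc 1 (w₁ x - w₂ x) ∂surfOn (frontier Ω)
        - ∫ x, lam x * σ (w₁ x) * trunc 1 (w₁ x - w₂ x) ∂surfOn (frontier Ω))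
      + (∫ x, f x * trunc 1 (u₂ x - u₁ x) ∂volOn Ω
        + ∫ x, H₂ x * trunc 1 (w₂ x - w₁ x) ∂surfOn (frontier Ω)
        - ∫ x, lam x * σ (w₂ x) * trunc 1 (w₂ x - w₁ x) ∂surfOn (frontier Ω))
      = ∫ x, (H₁ x - H₂ x) * trunc 1 (w₁ x - w₂ x) ∂surfOn (frontier Ω)
        - ∫ x, (lam x * σ (w₁ x) - lam x * σ (w₂ x)) * trunc 1 (w₁ x - w₂ x)
            ∂surfOn (frontier Ω) := by
    have hneg : ∀ s t : ℝ, trunc 1 (t - s) = - trunc 1 (s - t) := fun s t => by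
      rw [← trunc_neg zero_le_one, neg_sub]
    simp_rw [hneg (u₁ _) (u₂ _), hneg (w₁ _) (w₂ _), mul_neg, integral_neg, sub_mul]
    rw [integral_sub (hTw _ hu₁.integrable_H) (hTw _ hu₂.integrable_H),
      integral_sub (hTw _ hu₁.integrable_lam) (hTw _ hu₂.integrable_lam)]
    ring
  rw [hlim] at hflux
  set A := ∫ x, (H₁ x - H₂ x) * trunc 1 (w₁ x - w₂ x) ∂surfOn (frontier Ω) with hA
  set B := ∫ x, (lam x * σ (w₁ x) - lam x * σ (w₂ x)) * trunc 1 (w₁ x - w₂ x)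
    ∂surfOn (frontier Ω) with hB
  have hA0 : A ≤ 0 := integral_nonpos_of_ae hH
  have hB0 : 0 ≤ B := integral_nonneg_of_ae hσ
  -- the error terms
  set S : (Eucl N → ℝ) → (Eucl N → Eucl N) → ℕ → Eucl N → ℝ := fun u G n =>
    (bandSet u n).indicator (fun x => Z x + ‖G x‖ ^ p) with hS
  have hSi₁ : ∀ n : ℕ, 0 < n → Integrable (S u₁ G₁ n) (volOn Ω) := fun n hn =>
    hu₁.integrable_bandWeight hΩb hp hZ (by exact_mod_cast hn)
  have hSi₂ : ∀ n : ℕ, 0 < n → Integrable (S u₂ G₂ n) (volOn Ω) := fun n hn =>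
    hu₂.integrable_bandWeight hΩb hp hZ (by exact_mod_cast hn)
  have hSl₁ := hu₁.tendsto_bandWeight hΩ hΩb hp ha hf hZ
  have hSl₂ := hu₂.tendsto_bandWeight hΩ hΩb hp ha hf hZ
  -- With `r = n + 1`, the band above `r` has index `n + 1` and the band below has index `n`.
  have hErr := ((((tendsto_add_atTop_iff_nat 1).2 hSl₁).const_mul C).add hSl₂).add
    ((((tendsto_add_atTop_iff_nat 1).2 hSl₂).const_mul C).add hSl₁)
  simp only [mul_zero, add_zero] at hErr
  -- the monotonicity term
  set M : Eucl N → ℝ := fun x => inner ℝ (a x (G₁ x) - a x (G₂ x)) (G₁ x - G₂ x) with hM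
  have hM0 : ∀ᵐ x ∂volOn Ω, 0 ≤ M x := by
    filter_upwards [ha.monotone] with x hx
    by_cases h : G₁ x = G₂ x
    · simp [hM, h]
    · exact (hx _ _ h).le
  have hMm : AEStronglyMeasurable M (volOn Ω) :=
    (hu₁.aemeasurable_flux.sub hu₂.aemeasurable_flux).aestronglyMeasurable.inner
      (hu₁.truncGradient.1.sub hu₂.truncGradient.1).aestronglyMeasurable
  set R : ℕ → Set (Eucl N) := fun n =>
    {x | u₁ x ≤ (n : ℝ) + 1 ∧ u₂ x ≤ (n : ℝ) + 1 ∧ |u₁ x - u₂ x| < 1} with hR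
  have hRm : ∀ n, NullMeasurableSet (R n) (volOn Ω) := fun n =>
    (nullMeasurableSet_le hu₁.aemeasurable aemeasurable_const).inter
      ((nullMeasurableSet_le hu₂.aemeasurable aemeasurable_const).inter
        (nullMeasurableSet_lt (hu₁.aemeasurable.sub hu₂.aemeasurable).abs aemeasurable_const))
  have hRmono : ∀ m n, m ≤ n → R m ⊆ R n := by
    rintro m n hmn x ⟨h1, h2, h3⟩
    have : (m : ℝ) ≤ n := by exact_mod_cast hmn
    exact ⟨by linarith, by linarith, h3⟩
  have hKm : ∀ n, AEStronglyMeasurable ((R n).indicator M) (volOn Ω) := fun n =>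
    hMm.indicator₀ (hRm n)
  have hKle : ∀ n, ∀ᵐ x ∂volOn Ω, (R n).indicator M x
      ≤ (inner ℝ (a x (G₁ x)) (crossGrad ((n : ℝ) + 1) (u₁ x) (u₂ x) (G₁ x) (G₂ x))
          + inner ℝ (a x (G₂ x)) (crossGrad ((n : ℝ) + 1) (u₂ x) (u₁ x) (G₂ x) (G₁ x)))
        + ((C * S u₁ G₁ (n + 1) x + S u₂ G₂ n x) + (C * S u₂ G₂ (n + 1) x + S u₁ G₁ n x)) := by
    intro n
    filter_upwards [hco, hgr, hu₁.nonneg, hu₂.nonneg] with x hcx hgx h1 h2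
    have hin : ∀ ξ, 0 ≤ inner ℝ (a x ξ) ξ := fun ξ => le_trans (by positivity) (hcx ξ)
    have h3 := le_inner_crossGrad_add (r := (n : ℝ) + 1) (by positivity) h1 h2 (hin (G₁ x))
      (hin (G₂ x))
    have h4 := mul_norm_le_bandWeight (r := (n : ℝ) + 1) (s := u₁ x) (t := u₂ x) (η := G₂ x)
      hp hβ (hgx (G₁ x))
    have h5 := mul_norm_le_bandWeight (r := (n : ℝ) + 1) (s := u₂ x) (t := u₁ x) (η := G₁ x)
      hp hβ (hgx (G₂ x))
    have h6 : (R n).indicator M x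
        = if u₁ x ≤ (n : ℝ) + 1 ∧ u₂ x ≤ (n : ℝ) + 1 ∧ |u₁ x - u₂ x| < 1 then
          inner ℝ (a x (G₁ x) - a x (G₂ x)) (G₁ x - G₂ x) else 0 := by
      by_cases h : x ∈ R n
      · rw [indicator_of_mem h]; exact (if_pos h).symm
      · rw [indicator_of_notMem h]; exact (if_neg h).symm
    have h7 : ∀ (u : Eucl N → ℝ) (G : Eucl N → Eucl N) (k : ℕ), S u G k x
        = if (k : ℝ) < u x ∧ u x ≤ (k : ℝ) + 1 then |z x| ^ q + ‖G x‖ ^ p else 0 := by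
      intro u G k
      by_cases h : x ∈ bandSet u k
      · rw [hS]; simp only; rw [indicator_of_mem h]; exact (if_pos h).symm
      · rw [hS]; simp only; rw [indicator_of_notMem h]; exact (if_neg h).symm
    rw [h6, h7, h7, h7, h7]
    simp only [add_sub_cancel_right, Nat.cast_add, Nat.cast_one] at h3 h4 h5 ⊢
    linarith
  have hJ : ∀ n : ℕ, 0 < n → Integrable (fun x =>
      (inner ℝ (a x (G₁ x)) (crossGrad ((n : ℝ) + 1) (u₁ x) (u₂ x) (G₁ x) (G₂ x))
          + inner ℝ (a x (G₂ x)) (crossGrad ((n : ℝ) + 1) (u₂ x) (u₁ x) (G₂ x) (G₁ x)))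
        + ((C * S u₁ G₁ (n + 1) x + S u₂ G₂ n x) + (C * S u₂ G₂ (n + 1) x + S u₁ G₁ n x)))
      (volOn Ω) := fun n hn =>
    ((hu₁.integrable_cross hΩ hΩb hp hu₂ (by positivity)).add
      (hu₂.integrable_cross hΩ hΩb hp hu₁ (by positivity))).add
      ((((hSi₁ _ n.succ_pos).const_mul C).add (hSi₂ _ hn)).add
        (((hSi₂ _ n.succ_pos).const_mul C).add (hSi₁ _ hn)))
  have hK0 : ∀ n, 0 ≤ᵐ[volOn Ω] (R n).indicator M := fun n => by
    filter_upwards [hM0] with x hx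
    by_cases h : x ∈ R n
    · simpa [h] using hx
    · simp [h]
  -- Integrability of the monotonicity term is not known beforehand; it comes from the upper bound
  -- `hKle`.
  have hKi : ∀ n : ℕ, 0 < n → Integrable ((R n).indicator M) (volOn Ω) := fun n hn => by
    refine (hJ n hn).mono' (hKm n) ?_
    filter_upwards [hKle n, hK0 n] with x h1 h2
    rwa [Real.norm_of_nonneg h2]
  -- `m` stays fixed while `n → ∞`: the sets `R n` increase and `M ≥ 0`, so the bound for `n` also
  -- bounds the integral over `R m`.
  have hbound : ∀ m : ℕ, 0 < m → ∫ x, (R m).indicator M x ∂volOn Ω ≤ A - B := by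
    intro m hm
    have hlim2 := hflux.add hErr
    rw [add_zero] at hlim2
    refine ge_of_tendsto hlim2 ?_
    filter_upwards [eventually_ge_atTop m] with n hn
    have hn0 : 0 < n := hm.trans_le hn
    have hi1 := hu₁.integrable_cross hΩ hΩb hp hu₂ (r := (n : ℝ) + 1) (by positivity)
    have hi2 := hu₂.integrable_cross hΩ hΩb hp hu₁ (r := (n : ℝ) + 1) (by positivity)
    calc ∫ x, (R m).indicator M x ∂volOn Ω ≤ ∫ x, (R n).indicator M x ∂volOn Ω := by
          refine integral_mono_ae (hKi m hm) (hKi n hn0) ?_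
          filter_upwards [hM0] with x hx
          by_cases h : x ∈ R m
          · rw [indicator_of_mem h, indicator_of_mem (hRmono m n hn h)]
          · rw [indicator_of_notMem h]
            exact indicator_apply_nonneg fun _ => hx
      _ ≤ _ := integral_mono_ae (hKi n hn0) (hJ n hn0) (hKle n)
      _ = _ := by
          exact integral_flux_add_error hi1 hi2 (hSi₁ _ n.succ_pos) (hSi₂ _ hn0)
            (hSi₂ _ n.succ_pos) (hSi₁ _ hn0)
  have hnonneg : ∀ m : ℕ, 0 ≤ ∫ x, (R m).indicator M x ∂volOn Ω := fun m =>
    integral_nonneg_of_ae (hK0 m)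
  have hBzero : B = 0 := by linarith [hbound 1 one_pos, hnonneg 1]
  have hzero : ∀ m : ℕ, 0 < m → ∫ x, (R m).indicator M x ∂volOn Ω = 0 := fun m hm => by
    linarith [hbound m hm, hnonneg m]
  constructor
  · have h1 : ∀ᵐ x ∂volOn Ω, ∀ m : ℕ, (R (m + 1)).indicator M x = 0 := by
      rw [ae_all_iff]
      intro m
      exact (integral_eq_zero_iff_of_nonneg_ae (hK0 _) (hKi _ m.succ_pos)).1 (hzero _ m.succ_pos)
    filter_upwards [h1, ha.monotone] with x hx hmono hlt
    by_contra hne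
    obtain ⟨m, hm⟩ := exists_nat_ge (max (u₁ x) (u₂ x))
    have hxR : x ∈ R (m + 1) := by
      refine ⟨?_, ?_, hlt⟩ <;> push_cast
      · linarith [le_max_left (u₁ x) (u₂ x)]
      · linarith [le_max_right (u₁ x) (u₂ x)]
    have h2 := hx m
    rw [indicator_of_mem hxR] at h2
    exact (hmono _ _ hne).ne' h2
  · have hi : Integrable (fun x => (lam x * σ (w₁ x) - lam x * σ (w₂ x)) * trunc 1 (w₁ x - w₂ x))
        (surfOn (frontier Ω)) := hTw _ (hu₁.integrable_lam.sub hu₂.integrable_lam)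
    exact (integral_eq_zero_iff_of_nonneg_ae hσ hi).1 hBzero

/-- Hölder's inequality against the constant `1` on the bounded set `Ω` turns decay of the energy
into `L¹` decay. -/
lemma IsEntropyTriple.tendsto_integral_band_norm (hΩ : IsOpen Ω) (hΩb : Bornology.IsBounded Ω)
    (hp : 1 < p) (ha : IsLerayLions Ω p a) (hf : Integrable f (volOn Ω))
    (hu : IsEntropyTriple Ω p a f lam σ H u G w) :
    Tendsto (fun n : ℕ => ∫ x, ‖(bandSet u n).indicator G x‖ ∂volOn Ω) atTop (𝓝 0) := by
  have := isFiniteMeasure_volOn hΩb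
  have h1 := (hu.tendsto_energy hΩ hΩb hp ha hf).rpow_const (p := 1 / p)
    (Or.inr (by positivity))
  rw [Real.zero_rpow (by positivity)] at h1
  have h2 := h1.mul_const ((∫ _, (1 : ℝ) ^ (p / (p - 1)) ∂volOn Ω) ^ (1 / (p / (p - 1))))
  rw [zero_mul] at h2
  refine squeeze_zero' (Eventually.of_forall fun n => integral_nonneg fun x => norm_nonneg _) ?_ h2
  filter_upwards [eventually_gt_atTop 0] with n hn
  have hn : (0 : ℝ) < n := by exact_mod_cast hn
  have h3 := integral_mul_le_Lp_mul_Lq_of_nonneg (μ := volOn Ω)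
    (Real.HolderConjugate.conjExponent hp)
    (f := fun x => ‖(bandSet u n).indicator G x‖) (g := fun _ => 1)
    (Eventually.of_forall fun x => norm_nonneg _) (Eventually.of_forall fun x => zero_le_one)
    (hu.hasSobolevGradient_band hΩb hp hn).memLp_grad.norm (memLp_const 1)
  simp only [mul_one] at h3
  simp_rw [indicator_norm_rpow (show 0 < p by linarith)]
  exact h3

/-- If the gradients agree where the solutions are close, then the truncated difference of two
entropy solutions has vanishing weak derivatives. -/
lemma IsEntropyTriple.hasWeakDeriv_zero (hΩ : IsOpen Ω) (hΩb : Bornology.IsBounded Ω)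
    (hp : 1 < p) (ha : IsLerayLions Ω p a) (hf : Integrable f (volOn Ω))
    (hu₁ : IsEntropyTriple Ω p a f lam σ H₁ u₁ G₁ w₁)
    (hu₂ : IsEntropyTriple Ω p a f lam σ H₂ u₂ G₂ w₂)
    (hG : ∀ᵐ x ∂volOn Ω, |u₁ x - u₂ x| < 1 → G₁ x = G₂ x) (e : Eucl N) :
    HasWeakDeriv Ω (fun x => trunc 1 (u₁ x - u₂ x)) 0 e := by
  have := isFiniteMeasure_volOn hΩb
  have hgrad := fun n : ℕ =>
    hu₁.hasSobolevGradient_cross hΩ hΩb hp hu₂ (r := ((n + 1 : ℕ) : ℝ)) (by positivity)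
  have hb₁ := fun n : ℕ => ((hu₁.hasSobolevGradient_band hΩb hp
    (r := ((n + 1 : ℕ) : ℝ)) (by positivity)).integrable_grad hΩb hp).norm
  have hb₂ := fun n : ℕ => ((hu₂.hasSobolevGradient_band hΩb hp
    (r := ((n + 1 : ℕ) : ℝ)) (by positivity)).integrable_grad hΩb hp).norm
  have hl₁ := hu₁.tendsto_integral_band_norm hΩ hΩb hp ha hf
  have hl₂ := hu₂.tendsto_integral_band_norm hΩ hΩb hp ha hf
  have hm : AEStronglyMeasurable (fun x => trunc 1 (u₁ x - u₂ x)) (volOn Ω) :=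
    ((continuous_trunc 1).measurable.comp_aemeasurable
      (hu₁.aemeasurable.sub hu₂.aemeasurable)).aestronglyMeasurable
  -- The level `n + 2` keeps the lower endpoint `n + 1` of the band below it positive as well.
  have hDi : ∀ n : ℕ, Integrable (fun x => inner ℝ (crossGrad ((n + 1 + 1 : ℕ) : ℝ) (u₁ x) (u₂ x)
      (G₁ x) (G₂ x)) e) (volOn Ω) := fun n =>
    ((hgrad (n + 1)).integrable_grad hΩb hp).inner_const e
  refine HasWeakDeriv.of_tendsto (fun n => (hgrad (n + 1)).integrable hΩb hp) hDi
    (Integrable.of_bound hm 1 (Eventually.of_forall fun x => abs_trunc_le zero_le_one _))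
    (integrable_zero _ _ _) (fun n => (hgrad (n + 1)).hasWeakDeriv e) ?_ ?_
  · refine tendsto_integral_abs_sub_of_bounded
      (fun n => ((hgrad (n + 1)).integrable hΩb hp).aestronglyMeasurable) hm
      (integrable_const 1) (fun n => Eventually.of_forall fun x => abs_trunc_le zero_le_one _)
      (Eventually.of_forall fun x => ?_)
    have h1 := (tendsto_trunc_nat (u₂ x)).comp (tendsto_add_atTop_nat 2)
    exact ((continuous_trunc 1).tendsto _).comp (h1.const_sub (u₁ x))
  · have hsum := ((((tendsto_add_atTop_iff_nat 2).2 hl₁).add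
      ((tendsto_add_atTop_iff_nat 1).2 hl₁)).add
      ((tendsto_add_atTop_iff_nat 1).2 hl₂)).const_mul ‖e‖
    simp only [add_zero, mul_zero] at hsum
    refine squeeze_zero (fun n => integral_nonneg fun x => abs_nonneg _) (fun n => ?_) hsum
    rw [← integral_add (hb₁ (n + 1)) (hb₁ n),
      ← integral_add (f := fun x => ‖(bandSet u₁ ((n + 1 + 1 : ℕ) : ℝ)).indicator G₁ x‖
        + ‖(bandSet u₁ ((n + 1 : ℕ) : ℝ)).indicator G₁ x‖) ((hb₁ (n + 1)).add (hb₁ n)) (hb₂ n),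
      ← integral_const_mul]
    refine integral_mono_ae ((hDi n).sub (integrable_zero _ _ _)).abs
      ((((hb₁ (n + 1)).add (hb₁ n)).add (hb₂ n)).const_mul _) ?_
    filter_upwards [hG, hu₁.nonneg, hu₂.nonneg] with x hx h1 h2
    have h3 := norm_crossGrad_le (r := ((n + 1 + 1 : ℕ) : ℝ)) (by positivity) h1 h2 hx
    have h4 : ∀ (u : Eucl N → ℝ) (G : Eucl N → Eucl N) (r : ℝ), ‖(bandSet u r).indicator G x‖
        = if r < u x ∧ u x ≤ r + 1 then ‖G x‖ else 0 := by
      intro u G r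
      by_cases h : x ∈ bandSet u r
      · rw [indicator_of_mem h]; exact (if_pos h).symm
      · rw [indicator_of_notMem h, norm_zero]; exact (if_neg h).symm
    have h5 := abs_real_inner_le_norm
      (crossGrad ((n + 1 + 1 : ℕ) : ℝ) (u₁ x) (u₂ x) (G₁ x) (G₂ x)) e
    simp only [Pi.zero_apply, sub_zero, h4]
    refine h5.trans ?_
    rw [mul_comm]
    refine mul_le_mul_of_nonneg_left (h3.trans (le_of_eq ?_)) (norm_nonneg e)
    push_cast
    simp only [add_sub_cancel_right]

end Comparison

/-! ### Uniqueness -/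

lemma eq_zero_of_trunc_one_eq_zero {s : ℝ} (h : trunc 1 s = 0) : s = 0 := by
  by_contra hs
  rcases le_or_gt |s| 1 with h1 | h1
  · exact hs (by rwa [trunc_of_abs_le h1] at h)
  · rcases lt_abs.1 h1 with h2 | h2
    · rw [trunc_of_le zero_le_one h2.le] at h
      exact one_ne_zero h
    · rw [trunc_of_le_neg (by linarith)] at h
      norm_num at h

lemma trunc_nonpos {k s : ℝ} (hk : 0 ≤ k) (hs : s ≤ 0) : trunc k s ≤ 0 := by
  have := trunc_nonneg hk (neg_nonneg.2 hs)
  rw [trunc_neg hk] at this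
  linarith

lemma sub_mul_trunc_nonneg {ψ : ℝ → ℝ} (hψ : MonotoneOn ψ (Ici 0)) {s t : ℝ} (hs : 0 ≤ s)
    (ht : 0 ≤ t) : 0 ≤ (ψ s - ψ t) * trunc 1 (s - t) := by
  rcases le_total s t with h | h
  · exact mul_nonneg_of_nonpos_of_nonpos (sub_nonpos.2 (hψ hs ht h))
      (trunc_nonpos zero_le_one (sub_nonpos.2 h))
  · exact mul_nonneg (sub_nonneg.2 (hψ ht hs h)) (trunc_nonneg zero_le_one (sub_nonneg.2 h))

/-- `EReal.toReal` sends both infinities to `0`, so it preserves the order only if the larger value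
is not `⊤` and the smaller is not `⊥`. -/
lemma toReal_mul_le_of_antitoneOn {h : ℝ → EReal} (hh : AntitoneOn h (Ici 0)) {g s t : ℝ}
    (hg : 0 ≤ g) (hs : 0 ≤ s) (ht : 0 ≤ t) (hst : s ≤ t) (h1 : h s * (g : EReal) ≠ ⊤)
    (h2 : h t * (g : EReal) ≠ ⊥) : (h t * (g : EReal)).toReal ≤ (h s * (g : EReal)).toReal :=
  EReal.toReal_le_toReal
    (mul_le_mul_of_nonneg_right (hh hs ht hst) (EReal.coe_nonneg.2 hg)) h2 h1

/-- Here `b` stands for a common trace value. If `s` or `t` exceeds `m`, its truncation is at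
distance at least `1` from `b`, already enough; otherwise this is the triangle inequality. -/
lemma abs_trunc_one_sub_le {s t b m : ℝ} (hs : 0 ≤ s) (ht : 0 ≤ t) (hb : 0 ≤ b)
    (hbm : b + 1 ≤ m) : |trunc 1 (s - t)| ≤ |trunc m s - b| + |trunc m t - b| := by
  rcases le_or_gt s m with h1 | h1
  · rcases le_or_gt t m with h2 | h2
    · rw [trunc_of_abs_le (k := m) (by rwa [abs_of_nonneg hs]),
        trunc_of_abs_le (k := m) (by rwa [abs_of_nonneg ht]), abs_sub_comm t b]
      exact (abs_trunc_le_abs zero_le_one _).trans (abs_sub_le _ _ _)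
    · rw [trunc_of_le (k := m) (by linarith) h2.le]
      have := abs_trunc_le zero_le_one (s - t)
      have := abs_nonneg (trunc m s - b)
      have := le_abs_self (m - b)
      linarith
  · rw [trunc_of_le (k := m) (by linarith) h1.le]
    have := abs_trunc_le zero_le_one (s - t)
    have := abs_nonneg (trunc m t - b)
    have := le_abs_self (m - b)
    linarith

lemma eq_of_mul_trunc_eq_zero {σ : ℝ → ℝ} (hσ : StrictMonoOn σ (Ici 0)) {l s t : ℝ} (hl : l ≠ 0)
    (hs : 0 ≤ s) (ht : 0 ≤ t) (h : (l * σ s - l * σ t) * trunc 1 (s - t) = 0) : s = t := by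
  rcases mul_eq_zero.1 h with h1 | h1
  · rw [← mul_sub] at h1
    exact hσ.injOn hs ht (sub_eq_zero.1 ((mul_eq_zero.1 h1).resolve_left hl))
  · exact sub_eq_zero.1 (eq_zero_of_trunc_one_eq_zero h1)

/-- Two nonnegative functions whose truncated difference is constant on a component, and whose
traces agree somewhere on the boundary of the component, agree on the component. -/
lemma ae_eq_of_trace_eq {N : ℕ} {Ω : Set (Eucl N)} (hΩ : IsOpen Ω)
    (hΩb : Bornology.IsBounded Ω) (hL : HasLipschitzBoundary Ω) {u₁ u₂ w₁ w₂ : Eucl N → ℝ}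
    (hm₁ : AEMeasurable u₁ (volOn Ω)) (hm₂ : AEMeasurable u₂ (volOn Ω))
    (h₁ : ∀ᵐ x ∂volOn Ω, 0 ≤ u₁ x) (h₂ : ∀ᵐ x ∂volOn Ω, 0 ≤ u₂ x)
    (ht₁ : IsTruncTrace Ω u₁ w₁) (ht₂ : IsTruncTrace Ω u₂ w₂) {x₀ : Eucl N} {c : ℝ}
    (hc : ∀ᵐ x ∂volume.restrict (connectedComponentIn Ω x₀), trunc 1 (u₁ x - u₂ x) = c)
    (hw : ∃ᵐ x ∂surfOn (frontier (connectedComponentIn Ω x₀)), w₁ x = w₂ x) :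
    ∀ᵐ x ∂volume.restrict (connectedComponentIn Ω x₀), u₁ x = u₂ x := by
  have hle : surfOn (frontier (connectedComponentIn Ω x₀)) ≤ surfOn (frontier Ω) :=
    Measure.restrict_mono (frontier_connectedComponentIn_subset hΩ x₀) le_rfl
  have htr : ∀ (u w : Eucl N → ℝ), IsTruncTrace Ω u w → ∀ᵐ x ∂surfOn (frontier Ω), ∀ n : ℕ,
      Tendsto (fun r : ℝ => ⨍ y in Ω ∩ Metric.ball x r,
        |trunc (n + 1) (u y) - trunc (n + 1) (w x)|) (𝓝[>] 0) (𝓝 0) := fun u w h =>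
    ae_all_iff.2 fun n => h _ (by positivity)
  have hall := ae_mono hle ((htr _ _ ht₁).and ((htr _ _ ht₂).and
    (ht₁.ae_nonneg hΩ hΩb hm₁ h₁)))
  obtain ⟨x, hwx, ⟨hx₁, hx₂, hpos⟩, hxC⟩ :=
    (hw.and_eventually (Filter.Eventually.and hall (ae_mem_surfOn_frontier _))).exists
  -- Level `n + 1` leaves the trace value untouched and exceeds it by at least `1`, as
  -- `abs_trunc_one_sub_le` requires.
  obtain ⟨n, hn⟩ := exists_nat_ge (w₁ x)
  have htw : trunc ((n : ℝ) + 1) (w₁ x) = w₁ x :=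
    trunc_of_abs_le (by rw [abs_of_nonneg hpos]; linarith)
  have ha := hx₁ n
  have hb := hx₂ n
  rw [← hwx, htw] at hb
  rw [htw] at ha
  obtain ⟨δ, hδ, hδC⟩ := hL.exists_ball_inter_subset hΩ hxC
  have hc0 : |c| ≤ 0 := by
    have hn1 : (0 : ℝ) ≤ (n : ℝ) + 1 := by positivity
    refine le_zero_of_tendsto_average hΩ (frontier_connectedComponentIn_subset hΩ x₀ hxC)
      (integrable_trunc hΩb hm₁ hn1) (integrable_trunc hΩb hm₂ hn1) ha hb ?_
    filter_upwards [Ioo_mem_nhdsGT hδ] with r hr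
    have hsub : Ω ∩ Metric.ball x r ⊆ connectedComponentIn Ω x₀ :=
      (inter_subset_inter_right _ (Metric.ball_subset_ball hr.2.le)).trans hδC
    filter_upwards [ae_restrict_of_ae_restrict_of_subset hsub hc,
      ae_restrict_inter_of_ae_volOn h₁ (Metric.ball x r),
      ae_restrict_inter_of_ae_volOn h₂ (Metric.ball x r)] with y hy h1 h2
    rw [← hy]
    exact abs_trunc_one_sub_le h1 h2 hpos (by linarith)
  filter_upwards [hc] with y hy
  rw [abs_nonpos_iff.1 hc0] at hy
  exact sub_eq_zero.1 (eq_zero_of_trunc_one_eq_zero hy)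

theorem theorem3p4 {N : ℕ} (hN : 2 ≤ N) (Ω : Set (Eucl N))
    (hΩ_open : IsOpen Ω) (hΩ_bdd : Bornology.IsBounded Ω) (hΩ_lip : HasLipschitzBoundary Ω)
    (p : ℝ) (hp1 : 1 < p) (hpN : p < N)
    (a : Eucl N → Eucl N → Eucl N) (ha : IsLerayLions Ω p a)
    (f lam g : Eucl N → ℝ)
    (hf : Integrable f (volOn Ω))
    (hlam : Integrable lam (surfOn (frontier Ω)))
    (hlam_nonneg : ∀ᵐ x ∂surfOn (frontier Ω), 0 ≤ lam x)
    -- `lam` is not identically null on the boundary of any connected component of `Ω`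
    (hlam_ne : ∀ x₀ ∈ Ω,
      ¬ ∀ᵐ x ∂surfOn (frontier (connectedComponentIn Ω x₀)), lam x = 0)
    (hg : Integrable g (surfOn (frontier Ω)))
    (hg_nonneg : ∀ᵐ x ∂surfOn (frontier Ω), 0 ≤ g x)
    (σ : ℝ → ℝ) (hσ_cont : ContinuousOn σ (Ici 0)) (hσ_mono : StrictMonoOn σ (Ici 0))
    -- `h` is finite and continuous on `(0, ∞)`, and `h 0` is its limit at `0`, possibly `+∞`
    (h : ℝ → EReal) (hh_fin : ∀ s : ℝ, 0 < s → h s ≠ ⊤ ∧ h s ≠ ⊥)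
    (hh_cont : ContinuousOn h (Ici 0)) (hh_mono : AntitoneOn h (Ici 0))
    (u₁ u₂ : Eucl N → ℝ)
    (hu₁ : IsEntropySolution Ω p a f lam g σ h u₁)
    (hu₂ : IsEntropySolution Ω p a f lam g σ h u₂) :
    (∀ᵐ x ∂volOn Ω, u₁ x = u₂ x) ∧
      ∀ w₁ w₂ : Eucl N → ℝ, IsTruncTrace Ω u₁ w₁ → IsTruncTrace Ω u₂ w₂ →
        ∀ᵐ x ∂surfOn (frontier Ω), w₁ x = w₂ x := by

  obtain ⟨G₁, w₁, ht₁, hfin₁⟩ := hu₁.exists_triple hΩ_open hΩ_bdd hp1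
  obtain ⟨G₂, w₂, ht₂, hfin₂⟩ := hu₂.exists_triple hΩ_open hΩ_bdd hp1
  have hpos₁ := ht₁.truncTrace.ae_nonneg hΩ_open hΩ_bdd ht₁.aemeasurable ht₁.nonneg
  have hpos₂ := ht₂.truncTrace.ae_nonneg hΩ_open hΩ_bdd ht₂.aemeasurable ht₂.nonneg
  obtain ⟨hG, hB⟩ := ht₁.comparison hΩ_open hΩ_bdd hp1 ha hf ht₂
    (by
      filter_upwards [hpos₁, hpos₂, hlam_nonneg] with x h1 h2 h3
      rw [← mul_sub, mul_assoc]
      exact mul_nonneg h3 (sub_mul_trunc_nonneg hσ_mono.monotoneOn h1 h2))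
    (by
      filter_upwards [hpos₁, hpos₂, hg_nonneg, hfin₁, hfin₂] with x h1 h2 h3 h4 h5
      rcases le_total (w₁ x) (w₂ x) with hle | hle
      · exact mul_nonpos_of_nonneg_of_nonpos
          (sub_nonneg.2 (toReal_mul_le_of_antitoneOn hh_mono h3 h1 h2 hle h4.1 h5.2))
          (trunc_nonpos zero_le_one (sub_nonpos.2 hle))
      · exact mul_nonpos_of_nonpos_of_nonneg
          (sub_nonpos.2 (toReal_mul_le_of_antitoneOn hh_mono h3 h2 h1 hle h5.1 h4.2))
          (trunc_nonneg zero_le_one (sub_nonneg.2 hle)))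
  have hwd := ht₁.hasWeakDeriv_zero hΩ_open hΩ_bdd hp1 ha hf ht₂ hG
  have hint : Integrable (fun x => trunc 1 (u₁ x - u₂ x)) (volOn Ω) :=
    integrable_trunc hΩ_bdd (ht₁.aemeasurable.sub ht₂.aemeasurable) zero_le_one
  have hcomp : ∀ x₀ ∈ Ω, ∀ᵐ x ∂volume.restrict (connectedComponentIn Ω x₀), u₁ x = u₂ x := by
    intro x₀ hx₀
    obtain ⟨c, hc⟩ := exists_ae_eq_const hΩ_open hint hwd
      (isPreconnected_connectedComponentIn (x := x₀) (F := Ω)) hΩ_open.connectedComponentIn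
      (connectedComponentIn_subset Ω x₀)
    refine ae_eq_of_trace_eq hΩ_open hΩ_bdd hΩ_lip ht₁.aemeasurable ht₂.aemeasurable ht₁.nonneg
      ht₂.nonneg ht₁.truncTrace ht₂.truncTrace hc ?_
    have hle : surfOn (frontier (connectedComponentIn Ω x₀)) ≤ surfOn (frontier Ω) :=
      Measure.restrict_mono (frontier_connectedComponentIn_subset hΩ_open x₀) le_rfl
    -- Where `λ ≠ 0`, the vanishing integrand of `B` gives either `σ(w₁) = σ(w₂)` or `T_1(w₁ - w₂) =
    -- 0`; both mean `w₁ = w₂`.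
    have hne : ∃ᵐ x ∂surfOn (frontier (connectedComponentIn Ω x₀)), lam x ≠ 0 :=
      not_eventually.1 (hlam_ne x₀ hx₀)
    refine (hne.and_eventually (ae_mono hle (hB.and (hpos₁.and hpos₂)))).mono ?_
    rintro x ⟨h1, h2, h3, h4⟩
    exact eq_of_mul_trunc_eq_zero hσ_mono h1 h3 h4 h2
  have heq : ∀ᵐ x ∂volOn Ω, u₁ x = u₂ x := by
    rw [volOn, ae_restrict_iff' hΩ_open.measurableSet, ae_iff]
    -- Components are open, so nullity on each of them is local nullity, and no count of the
    -- components is needed.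
    refine measure_null_of_locally_null _ fun x hx => ?_
    simp only [mem_ofPred_eq, Classical.not_imp] at hx
    refine ⟨connectedComponentIn Ω x ∩ {y | ¬ (y ∈ Ω → u₁ y = u₂ y)},
      inter_mem (mem_nhdsWithin_of_mem_nhds (hΩ_open.connectedComponentIn.mem_nhds
        (mem_connectedComponentIn hx.1))) self_mem_nhdsWithin, ?_⟩
    have h1 := hcomp x hx.1
    rw [ae_restrict_iff' hΩ_open.connectedComponentIn.measurableSet, ae_iff] at h1
    refine measure_mono_null ?_ h1
    rintro y ⟨hy1, hy2⟩
    simp only [mem_ofPred_eq, Classical.not_imp] at hy2 ⊢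
    exact ⟨hy1, hy2.2⟩
  exact ⟨heq, fun v₁ v₂ hv₁ hv₂ => hv₁.ae_eq hΩ_open hΩ_bdd ht₁.aemeasurable heq hv₂⟩
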